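/- Let $n\ge 2$ and let $$W_8=\{x\in\mathbb R^{2n} : x_1^2+x_3^3=0,\ x_2^2+x_1x_3=0,\ x_j=0 \text{ for } j\ge 4\}.$$ All forms are germs at $0\in\mathbb R^{2n}$ of $C^\infty$ differential forms. For a subset $N\subset\mathbb R^{2n}$, two germs $\omega,\tilde\omega$ of $2$-forms have the same algebraic restriction to $N$, written $[\omega]_N=[\tilde\omega]_N$, if $\omega-\tilde\omega=\alpha+d\beta$ for a germ $\alpha$ of a $2$-form and a germ $\beta$ of a $1$-form that both vanish at every point of $N$ near $0$. Let $[Z^2(\mathbb R^{2n})]_{W_8}$ be the vector space of algebraic restrictions to $W_8$ of closed $2$-forms, and $[\mathrm{Symp}(\mathbb R^{2n})]_{W_8}$ its subset of algebraic restrictions to $W_8$ of symplectic forms (closed and nondegenerate $2$-forms). Set $$\theta_1=dx_2\wedge dx_3,\quad \theta_2=dx_1\wedge dx_3,\quad \theta_3=dx_1\wedge dx_2,\quad \theta_4=x_3\,dx_2\wedge dx_3,\quad \theta_5=x_2\,dx_2\wedge dx_3,$$ $$\theta_6=x_1\,dx_2\wedge dx_3+x_2\,dx_1\wedge dx_3,\quad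 \theta_7=x_3^2\,dx_2\wedge dx_3,\quad \theta_8=x_2^2\,dx_2\wedge dx_3 .$$ Then: 1. $[Z^2(\mathbb R^{2n})]_{W_8}$ is an $8$-dimensional real vector space, with basis $[\theta_1]_{W_8},\dots,[\theta_8]_{W_8}$. 2. For weights $6,5,4$ of $x_1,x_2,x_3$ (and any positive weights of the remaining coordinates), the forms $\theta_1,\dots,\theta_8$ are quasi-homogeneous of degrees $9,10,11,13,14,15,17,19$, respectively: the pullback of $\theta_i$ by $x\mapsto(t^{w_1}x_1,\dots,t^{w_{2n}}x_{2n})$ is $t^{\delta_i}\theta_i$ for every $t>0$, where $w_j$ is the weight of $x_j$ and $\delta_i$ is the degree of $\theta_i$. 3. If $n\ge 3$, then $[\mathrm{Symp}(\mathbb R^{2n})]_{W_8}=[Z^2(\mathbb R^{2n})]_{W_8}$. 4. If $n=2$, then $[\mathrm{Symp}(\mathbb R^{4})]_{W_8}$ is an open part of the $8$-dimensional space $[Z^2(\mathbb R^{4})]_{W_8}$; it consists exactly of the algebraic restrictions $[c_1\theta_1+\dots+c_8\theta_8]_{W_8}$ with $c_1,\dots,c_8\in\mathbb R$ and $(c_1,c_2,c_3)\neq(0,0,0)$.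 -/

import Mathlib

open Filter Topology
open scoped ContDiff

noncomputable section

namespace SymplecticW8

/-! ### Germs at the origin of smooth differential forms -/

section Germs

variable (E : Type*) [NormedAddCommGroup E] [NormedSpace ℝ E]

/-- The germs at `0` of smooth (`C^∞`) differential `p`-forms on `E`: the germs with some
(equivalently, every) representative smooth on a neighbourhood of `0`. -/
def smoothGerms (p : ℕ) : Submodule ℝ (Germ (𝓝 (0 : E)) (E [⋀^Fin p]→L[ℝ] ℝ)) where
  carrier := {g | ∃ σ : E → E [⋀^Fin p]→L[ℝ] ℝ,
    (∀ᶠ x in 𝓝 (0 : E), ContDiffAt ℝ ∞ σ x) ∧ g = (σ : Germ (𝓝 (0 : E)) (E [⋀^Fin p]→L[ℝ] ℝ))}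
  zero_mem' := ⟨0, Eventually.of_forall fun _ => contDiffAt_const, rfl⟩
  add_mem' := by
    rintro _ _ ⟨σ, hσ, rfl⟩ ⟨η, hη, rfl⟩
    refine ⟨σ + η, ?_, rfl⟩
    filter_upwards [hσ, hη] with x h1 h2 using h1.add h2
  smul_mem' := by
    rintro c _ ⟨σ, hσ, rfl⟩
    refine ⟨c • σ, ?_, rfl⟩
    filter_upwards [hσ] with x h using h.const_smul c

/-- The vector space `Λ^p(E)` of germs at `0` of smooth differential `p`-forms on `E`. -/
def FormGerm (p : ℕ) : Type _ := smoothGerms E p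

instance (p : ℕ) : AddCommGroup (FormGerm E p) := inferInstanceAs (AddCommGroup (smoothGerms E p))

instance (p : ℕ) : Module ℝ (FormGerm E p) := inferInstanceAs (Module ℝ (smoothGerms E p))

variable {E}

/-- The underlying germ of a germ of a smooth form. -/
def FormGerm.toGerm {p : ℕ} (g : FormGerm E p) : Germ (𝓝 (0 : E)) (E [⋀^Fin p]→L[ℝ] ℝ) := g.1

theorem FormGerm.toGerm_add {p : ℕ} (g h : FormGerm E p) :
    (g + h).toGerm = g.toGerm + h.toGerm := rfl

theorem FormGerm.toGerm_smul {p : ℕ} (c : ℝ) (g : FormGerm E p) :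
    (c • g).toGerm = c • g.toGerm := rfl

/-- The germ at `0` of a form that is smooth near `0`. -/
def FormGerm.mk {p : ℕ} (σ : E → E [⋀^Fin p]→L[ℝ] ℝ)
    (hσ : ∀ᶠ x in 𝓝 (0 : E), ContDiffAt ℝ ∞ σ x) : FormGerm E p :=
  ⟨(σ : Germ (𝓝 (0 : E)) (E [⋀^Fin p]→L[ℝ] ℝ)), σ, hσ, rfl⟩

theorem contDiffAt_extDeriv {p : ℕ} {σ : E → E [⋀^Fin p]→L[ℝ] ℝ} {x : E}
    (h : ContDiffAt ℝ ∞ σ x) : ContDiffAt ℝ ∞ (extDeriv σ) x := by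
  change ContDiffAt ℝ ∞
    (fun y => ContinuousAlternatingMap.alternatizeUncurryFinCLM ℝ E ℝ (fderiv ℝ σ y)) x
  exact (ContinuousLinearMap.contDiff _).contDiffAt.comp x (h.fderiv_right (m := ∞) le_rfl)

/-- The exterior derivative of germs of arbitrary forms, computed on representatives. -/
def germExtDeriv (p : ℕ) :
    Germ (𝓝 (0 : E)) (E [⋀^Fin p]→L[ℝ] ℝ) → Germ (𝓝 (0 : E)) (E [⋀^Fin (p + 1)]→L[ℝ] ℝ) :=
  Germ.map' extDeriv fun _ _ h => h.extDeriv

theorem germExtDeriv_coe (p : ℕ) (σ : E → E [⋀^Fin p]→L[ℝ] ℝ) :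
    germExtDeriv p (σ : Germ (𝓝 (0 : E)) (E [⋀^Fin p]→L[ℝ] ℝ)) =
      (extDeriv σ : Germ (𝓝 (0 : E)) (E [⋀^Fin (p + 1)]→L[ℝ] ℝ)) := rfl

/-- The exterior derivative `d : Λ^p(E) → Λ^{p+1}(E)` on germs of smooth forms. -/
def d (p : ℕ) : FormGerm E p →ₗ[ℝ] FormGerm E (p + 1) where
  toFun g := ⟨germExtDeriv p g.toGerm, by
    obtain ⟨_, σ, hσ, rfl⟩ := g
    exact ⟨extDeriv σ, hσ.mono fun _ h => contDiffAt_extDeriv h, rfl⟩⟩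
  map_add' := by
    rintro ⟨_, σ, hσ, rfl⟩ ⟨_, η, hη, rfl⟩
    apply Subtype.ext
    refine Germ.coe_eq.2 ?_
    filter_upwards [hσ, hη] with x h1 h2
    exact extDeriv_add (h1.differentiableAt (by simp)) (h2.differentiableAt (by simp))
  map_smul' := by
    rintro c ⟨_, σ, hσ, rfl⟩
    apply Subtype.ext
    refine Germ.coe_eq.2 (Eventually.of_forall fun x => ?_)
    exact extDeriv_smul c σ

/-- `Λ^p_N(E)`: germs of `p`-forms `σ` with `σ(x) = 0` for every point `x` of (the germ at `0`
of) `N`. -/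
def vanishingForms (N : Set E) (p : ℕ) : Submodule ℝ (FormGerm E p) where
  carrier := {g | ∃ σ : E → E [⋀^Fin p]→L[ℝ] ℝ,
    g.toGerm = (σ : Germ (𝓝 (0 : E)) (E [⋀^Fin p]→L[ℝ] ℝ)) ∧ ∀ᶠ x in 𝓝 (0 : E), x ∈ N → σ x = 0}
  zero_mem' := ⟨0, rfl, Eventually.of_forall fun _ _ => rfl⟩
  add_mem' := by
    rintro a b ⟨σ, ha, hσ⟩ ⟨η, hb, hη⟩
    refine ⟨σ + η, by rw [FormGerm.toGerm_add, ha, hb]; rfl, ?_⟩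
    filter_upwards [hσ, hη] with x h1 h2 hx
    simp [h1 hx, h2 hx]
  smul_mem' := by
    rintro c a ⟨σ, ha, hσ⟩
    refine ⟨c • σ, by rw [FormGerm.toGerm_smul, ha]; rfl, ?_⟩
    filter_upwards [hσ] with x h hx
    simp [h hx]

/-- `𝒜_0²(N, E) = {α + dβ : α ∈ Λ²_N(E), β ∈ Λ¹_N(E)}`: the 2-forms with zero algebraic
restriction to `N`. -/
def zeroAlgRestr (N : Set E) : Submodule ℝ (FormGerm E 2) :=
  vanishingForms N 2 ⊔ (vanishingForms N 1).map (d 1)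

/-- The space of algebraic restrictions to `N` of germs of 2-forms. -/
abbrev AlgRestr (N : Set E) : Type _ := FormGerm E 2 ⧸ zeroAlgRestr N

/-- The algebraic restriction `[σ]_N` of a germ of a 2-form. -/
def algRestr (N : Set E) : FormGerm E 2 →ₗ[ℝ] AlgRestr N := (zeroAlgRestr N).mkQ

/-- `[Z²(E)]_N`: the algebraic restrictions to `N` of germs of closed 2-forms. -/
def closedRestr (N : Set E) : Submodule ℝ (AlgRestr N) :=
  (LinearMap.ker (d (E := E) 2)).map (algRestr N)

/-- A germ of a symplectic form: a closed 2-form that is nondegenerate at every point near `0`. -/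
def IsSymplectic (g : FormGerm E 2) : Prop :=
  d 2 g = 0 ∧ g.toGerm.LiftPred fun η => ∀ v : E, (∀ w : E, η ![v, w] = 0) → v = 0

/-- `[Symp(E)]_N`: the algebraic restrictions to `N` of germs of symplectic forms. -/
def sympRestr (N : Set E) : Set (AlgRestr N) := algRestr N '' {g | IsSymplectic g}

/-- The wedge product `a ∧ b` of two linear forms, see `wedge_apply`. -/
def wedge (a b : E →L[ℝ] ℝ) : E [⋀^Fin 2]→L[ℝ] ℝ :=
  ContinuousMultilinearMap.alternatization
    ((ContinuousMultilinearMap.mkPiAlgebra ℝ (Fin 2) ℝ).compContinuousLinearMap ![a, b])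

theorem wedge_apply (a b : E →L[ℝ] ℝ) (v : Fin 2 → E) :
    wedge a b v = a (v 0) * b (v 1) - a (v 1) * b (v 0) := by
  have h : (Finset.univ : Finset (Equiv.Perm (Fin 2))) = {1, Equiv.swap 0 1} := by decide
  have h' : (1 : Equiv.Perm (Fin 2)) ∉ ({Equiv.swap 0 1} : Finset (Equiv.Perm (Fin 2))) := by
    decide
  rw [wedge, ContinuousMultilinearMap.alternatization_apply_apply, h, Finset.sum_insert h']
  simp [Fin.prod_univ_two, sub_eq_add_neg]

end Germs

/-! ### Quasi-homogeneous forms on `ℝ^m` -/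

/-- The dilation `(x_1, …, x_m) ↦ (t^{w_1} x_1, …, t^{w_m} x_m)`. -/
def dilation {m : ℕ} (w : Fin m → ℝ) (t : ℝ) : (Fin m → ℝ) →L[ℝ] (Fin m → ℝ) :=
  ContinuousLinearMap.pi fun j => (t ^ w j) • ContinuousLinearMap.proj j

/-- `σ` is quasi-homogeneous of degree `δ` for the weights `w`: its pullback by the dilation with
parameter `t` is `t^δ σ`, for every `t > 0`. -/
def IsQuasiHomogeneous {m p : ℕ} (w : Fin m → ℝ) (δ : ℝ)
    (σ : (Fin m → ℝ) → (Fin m → ℝ) [⋀^Fin p]→L[ℝ] ℝ) : Prop :=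
  ∀ t : ℝ, 0 < t → ∀ x : Fin m → ℝ,
    (σ (dilation w t x)).compContinuousLinearMap (dilation w t) = t ^ δ • σ x

/-! ### The singularity `W_8` in `ℝ^{2n}` -/

section W8

variable {n : ℕ} (hn : 2 ≤ n)

/-- The position of the coordinate `x_{k+1}`, `k = 0, 1, 2`, of `ℝ^{2n}`. -/
def ix (k : Fin 3) : Fin (2 * n) := Fin.castLE (by omega) k

/-- `W_8 = {x ∈ ℝ^{2n} : x_1² + x_3³ = x_2² + x_1 x_3 = x_{≥ 4} = 0}`. -/
def W8 : Set (Fin (2 * n) → ℝ) :=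
  {x | x (ix hn 0) ^ 2 + x (ix hn 2) ^ 3 = 0 ∧ x (ix hn 1) ^ 2 + x (ix hn 0) * x (ix hn 2) = 0 ∧
    ∀ j : Fin (2 * n), 3 ≤ (j : ℕ) → x j = 0}

/-- The linear form `dx_{k+1}`, `k = 0, 1, 2`. -/
def dx (k : Fin 3) : (Fin (2 * n) → ℝ) →L[ℝ] ℝ := ContinuousLinearMap.proj (ix hn k)

/-- The 2-forms `θ_1, …, θ_8` on `ℝ^{2n}` (`θ_i` is `theta hn (i - 1)`). -/
def theta (i : Fin 8) (x : Fin (2 * n) → ℝ) : (Fin (2 * n) → ℝ) [⋀^Fin 2]→L[ℝ] ℝ :=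
  ![wedge (dx hn 1) (dx hn 2),
    wedge (dx hn 0) (dx hn 2),
    wedge (dx hn 0) (dx hn 1),
    x (ix hn 2) • wedge (dx hn 1) (dx hn 2),
    x (ix hn 1) • wedge (dx hn 1) (dx hn 2),
    x (ix hn 0) • wedge (dx hn 1) (dx hn 2) + x (ix hn 1) • wedge (dx hn 0) (dx hn 2),
    x (ix hn 2) ^ 2 • wedge (dx hn 1) (dx hn 2),
    x (ix hn 1) ^ 2 • wedge (dx hn 1) (dx hn 2)] i

theorem contDiff_theta (i : Fin 8) : ContDiff ℝ ∞ (theta hn i) := by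
  have h : ∀ k : Fin 3, ContDiff ℝ ∞ fun x : Fin (2 * n) → ℝ => x (ix hn k) :=
    fun k => contDiff_apply ℝ ℝ (ix hn k)
  fin_cases i
  · exact contDiff_const
  · exact contDiff_const
  · exact contDiff_const
  · exact (h 2).smul contDiff_const
  · exact (h 1).smul contDiff_const
  · exact ((h 0).smul contDiff_const).add ((h 1).smul contDiff_const)
  · exact ((h 2).pow 2).smul contDiff_const
  · exact ((h 1).pow 2).smul contDiff_const

/-- The germ of `θ_{i+1}` at `0`. -/
def thetaGerm (i : Fin 8) : FormGerm (Fin (2 * n) → ℝ) 2 :=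
  FormGerm.mk (theta hn i) (Eventually.of_forall fun _ => (contDiff_theta hn i).contDiffAt)

/-- The degrees `δ_1, …, δ_8`. -/
def degree : Fin 8 → ℝ := ![9, 10, 11, 13, 14, 15, 17, 19]

end W8

end SymplecticW8

end

/-!
# Algebraic restrictions of closed 2-forms to the curve `W_8`

The forms with zero algebraic restriction to `N` make up a module over the smooth functions,
generated by the `f σ` and the `df ∧ ξ`, for `f` vanishing on `N` (`wedgeRestr_eq_zero`,
`sum_wedgeRestr_eq_zero`). The quotient for `N = W_8` is a module of Kähler 2-forms of a curve with
an isolated singularity, so it has finite dimension. The proof computes it, from above and from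
below.

*Generation.* The functions `x_1² + x_3³`, `x_2² + x_1 x_3` and `x_j`, `j ≥ 4`, vanish on `W_8`. The
relations `f σ ~ 0` and `df ∧ ξ ~ 0` for them, together with Hadamard's lemma
(`exists_contDiff_hadamard`), reduce every smooth 2-form to a real combination of `θ_1, …, θ_8` and
of `x_1 dx_2 ∧ dx_3` (`mem_of_relations`, `exists_algRestr_eq_add`). The ninth form is the only one
that is not closed. If the 2-form is closed, its ninth coefficient is zero, since the component of
`dσ` along `dx_1 ∧ dx_2 ∧ dx_3` vanishes at `0` for every `σ` with zero algebraic restriction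
(`extDeriv_apply_eq_zero_of_mem_zeroAlgRestr`). No primitive of the closed form is needed.

*Independence.* The curve `t ↦ (t⁶, t⁵, -t⁴, 0, …, 0)` runs through `W_8`. If a smooth function
vanishes on `W_8`, substituting the curve into its Taylor formula of order three leaves a polynomial
in `t` of order `O(t ^ 16)`, so all its coefficients below `t ^ 16` vanish (`jet_of_vanishing`).
These relations show that certain linear combinations of partial derivatives at `0` of the
components of a 2-form vanish on the forms with zero algebraic restriction
(`jet_of_mem_zeroAlgRestr`), and these functionals separate `θ_1, …, θ_8`.

*Symplectic forms.* Adding to a closed form constant multiples of forms `dx_i ∧ dx_j` with `j ≥ 4`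
does not change its algebraic restriction. For `n ≥ 3` every value at `0` can be made nondegenerate
in this way. For `n = 2` this is possible exactly if the value at `0` of the form does not vanish on
the span of the first three basis vectors, and `c_1, c_2, c_3` are the components of this value.
-/

noncomputable section

namespace SymplecticW8

/-! ### Calculus of smooth functions -/

section Calculus

universe u

/-- Smooth dependence on parameters of an integral over `[0, 1]`. -/
theorem contDiff_nat_integral_param {E : Type u} [NormedAddCommGroup E] [NormedSpace ℝ E]
    [FiniteDimensional ℝ E] (k : ℕ) : ∀ {F : Type u} [NormedAddCommGroup F] [NormedSpace ℝ F]
    [CompleteSpace F] {H : E × ℝ → F},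
    ContDiff ℝ k H → ContDiff ℝ k fun x => ∫ t in (0 : ℝ)..1, H (x, t) := by
  induction k with
  | zero =>
    intro F _ _ _ H hH
    rw [Nat.cast_zero, contDiff_zero] at hH ⊢
    exact intervalIntegral.continuous_parametric_intervalIntegral_of_continuous'
      (f := fun x t => H (x, t)) hH 0 1
  | succ k ih =>
    intro F _ _ _ H hH
    have hd : ContDiff ℝ k fun p : E × ℝ =>
        (fderiv ℝ H p).comp (ContinuousLinearMap.inl ℝ E ℝ) :=
      (hH.fderiv_right (m := k) (by norm_cast)).clm_comp contDiff_const
    have hdiff : Differentiable ℝ H := hH.differentiable (by simp)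
    rw [Nat.cast_succ, contDiff_succ_iff_hasFDerivAt]
    refine ⟨_, ih hd, fun x => ?_⟩
    obtain ⟨C, hC⟩ := ((isCompact_closedBall x 1).prod (isCompact_Icc (a := (0 : ℝ)) (b := 1))
      ).exists_bound_of_continuousOn hd.continuous.continuousOn
    refine intervalIntegral.hasFDerivAt_integral_of_dominated_of_fderiv_le
      (F' := fun x t => (fderiv ℝ H (x, t)).comp (ContinuousLinearMap.inl ℝ E ℝ))
      (bound := fun _ => C) (Metric.closedBall_mem_nhds x one_pos) ?_ ?_ ?_ ?_ ?_ ?_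
    · exact Eventually.of_forall fun y =>
        (hH.continuous.comp (Continuous.prodMk_right y)).aestronglyMeasurable
    · exact (hH.continuous.comp (Continuous.prodMk_right x)).intervalIntegrable _ _
    · exact (hd.continuous.comp (Continuous.prodMk_right x)).aestronglyMeasurable
    · refine Eventually.of_forall fun t ht y hy => hC (y, t) ⟨hy, ?_⟩
      rw [Set.uIoc_of_le zero_le_one] at ht
      exact ⟨ht.1.le, ht.2⟩
    · exact intervalIntegrable_const
    · refine Eventually.of_forall fun t _ y _ => ?_
      exact (hdiff (y, t)).hasFDerivAt.comp y (hasFDerivAt_prodMk_left y t)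

theorem contDiff_integral_param {E F : Type u} [NormedAddCommGroup E] [NormedSpace ℝ E]
    [FiniteDimensional ℝ E] [NormedAddCommGroup F] [NormedSpace ℝ F] [CompleteSpace F]
    {H : E × ℝ → F} (hH : ContDiff ℝ ∞ H) :
    ContDiff ℝ ∞ fun x => ∫ t in (0 : ℝ)..1, H (x, t) :=
  contDiff_infty.2 fun k => contDiff_nat_integral_param k (contDiff_infty.1 hH k)

/-- Hadamard's lemma. -/
theorem exists_contDiff_hadamard {E : Type} [NormedAddCommGroup E] [NormedSpace ℝ E]
    [FiniteDimensional ℝ E] {f : E → ℝ} (hf : ContDiff ℝ ∞ f) :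
    ∃ g : E → E →L[ℝ] ℝ, ContDiff ℝ ∞ g ∧ ∀ x, f x = f 0 + g x x := by
  have hd : ContDiff ℝ ∞ fun p : E × ℝ => fderiv ℝ f (p.2 • p.1) :=
    (hf.fderiv_right (m := ∞) le_rfl).comp (contDiff_snd.smul contDiff_fst)
  refine ⟨fun x => ∫ t in (0 : ℝ)..1, fderiv ℝ f (t • x), contDiff_integral_param hd, fun x => ?_⟩
  have h := map_add_eq_sum_add_integral_iteratedFDeriv (f := f) (x := 0) (y := x) (n := 0)
    fun t _ => (contDiff_infty.1 hf 1).contDiffAt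
  have happ := ContinuousLinearMap.intervalIntegral_apply (v := x)
    ((hd.continuous.comp (Continuous.prodMk_right x)).intervalIntegrable
      (μ := MeasureTheory.volume) 0 1)
  have h' : f x = f 0 + ∫ t in (0 : ℝ)..1, fderiv ℝ f (t • x) x := by simpa using h
  rw [h']
  exact congrArg (f 0 + ·) happ.symm

/-- A map that is smooth near `0` agrees near `0` with a map that is smooth everywhere. -/
theorem exists_contDiff_eventuallyEq {E F : Type*} [NormedAddCommGroup E] [NormedSpace ℝ E]
    [FiniteDimensional ℝ E] [NormedAddCommGroup F] [NormedSpace ℝ F] {f : E → F}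
    (hf : ∀ᶠ x in 𝓝 (0 : E), ContDiffAt ℝ ∞ f x) :
    ∃ g : E → F, ContDiff ℝ ∞ g ∧ f =ᶠ[𝓝 0] g := by
  obtain ⟨r, hr, hball⟩ := Metric.eventually_nhds_iff_ball.1 hf
  let χ : ContDiffBump (0 : E) := ⟨r / 3, r / 2, by positivity, by linarith⟩
  refine ⟨fun x => χ x • f x, contDiff_iff_contDiffAt.2 fun x => ?_, ?_⟩
  · by_cases hx : x ∈ Metric.ball (0 : E) r
    · exact χ.contDiffAt.smul (hball x hx)
    · have hx' : x ∉ tsupport χ := by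
        rw [χ.tsupport_eq]
        intro h
        have : dist x 0 ≤ r / 2 := h
        exact hx (by rw [Metric.mem_ball]; linarith)
      refine (contDiffAt_const (c := (0 : F))).congr_of_eventuallyEq ?_
      filter_upwards [(isClosed_tsupport (χ : E → ℝ)).isOpen_compl.mem_nhds hx'] with y hy
      rw [image_eq_zero_of_notMem_tsupport hy, zero_smul]
  · filter_upwards [χ.eventuallyEq_one] with x hx
    simp [hx]

/-- The coefficients of a polynomial function of order `O(t ^ n)` at `0` vanish below `n`. -/
theorem coeff_eq_zero_of_eventually_eval_eq {n : ℕ} {p : Polynomial ℝ} {R : ℝ → ℝ}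
    (hR : ContinuousAt R 0) (h : ∀ᶠ t in 𝓝 (0 : ℝ), p.eval t = t ^ n * R t) :
    ∀ i < n, p.coeff i = 0 := by
  rw [← Polynomial.X_pow_dvd_iff]
  induction n generalizing R with
  | zero => simp
  | succ n ih =>
    obtain ⟨q, rfl⟩ := ih (R := fun t => t * R t) (continuousAt_id.mul hR)
      (h.mono fun t ht => by rw [ht]; ring)
    have hq : ∀ᶠ t in 𝓝[≠] (0 : ℝ), q.eval t = t * R t := by
      filter_upwards [nhdsWithin_le_nhds h, self_mem_nhdsWithin] with t ht h0
      have h0' : t ^ n ≠ 0 := pow_ne_zero _ h0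
      apply mul_left_cancel₀ h0'
      rw [Polynomial.eval_mul, Polynomial.eval_pow, Polynomial.eval_X] at ht
      rw [ht]; ring
    have h1 : Tendsto (fun t => q.eval t) (𝓝[≠] (0 : ℝ)) (𝓝 (q.eval 0)) :=
      q.continuous.continuousAt.tendsto.mono_left nhdsWithin_le_nhds
    have h2 : Tendsto (fun t => t * R t) (𝓝[≠] (0 : ℝ)) (𝓝 0) := by
      simpa using ((continuousAt_id.tendsto.mul hR.tendsto).mono_left
        (nhdsWithin_le_nhds (s := {0}ᶜ)) : Tendsto (fun t => t * R t) _ _)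
    have h3 : q.eval 0 = 0 := tendsto_nhds_unique (h1.congr' hq) h2
    rw [pow_succ]
    exact mul_dvd_mul_left _ (Polynomial.X_dvd_iff.2 (by
      rwa [Polynomial.coeff_zero_eq_eval_zero]))

end Calculus

section SmoothFunctions

variable (E : Type*) [NormedAddCommGroup E] [NormedSpace ℝ E]

/-- The algebra of smooth functions on `E`. -/
def smoothFun : Subalgebra ℝ (E → ℝ) where
  carrier := {f | ContDiff ℝ ∞ f}
  mul_mem' {f g} (hf : ContDiff ℝ ∞ f) (hg : ContDiff ℝ ∞ g) := hf.mul hg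
  add_mem' {f g} (hf : ContDiff ℝ ∞ f) (hg : ContDiff ℝ ∞ g) := hf.add hg
  algebraMap_mem' c := (contDiff_const : ContDiff ℝ ∞ fun _ : E => c)

variable {E}

theorem contDiff_coe (f : smoothFun E) : ContDiff ℝ ∞ f.1 := f.2

/-- The directional derivative `f ↦ ∂_v f` on smooth functions, linear in `v`. -/
def pd : E →ₗ[ℝ] Module.End ℝ (smoothFun E) where
  toFun v :=
    { toFun := fun f => ⟨fun x => fderiv ℝ f.1 x v,
        ((contDiff_coe f).fderiv_right (m := ∞) le_rfl).clm_apply contDiff_const⟩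
      map_add' := fun f g => by
        ext x
        have hf : DifferentiableAt ℝ f.1 x := (contDiff_coe f).differentiable (by simp) x
        have hg : DifferentiableAt ℝ g.1 x := (contDiff_coe g).differentiable (by simp) x
        change fderiv ℝ (f.1 + g.1) x v = fderiv ℝ f.1 x v + fderiv ℝ g.1 x v
        rw [fderiv_add hf hg]; rfl
      map_smul' := fun c f => by
        ext x
        have hf : DifferentiableAt ℝ f.1 x := (contDiff_coe f).differentiable (by simp) x
        change fderiv ℝ (c • f.1) x v = c * fderiv ℝ f.1 x v
        rw [fderiv_const_smul hf]; rfl }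
  map_add' v w := by ext f x; exact map_add (fderiv ℝ f.1 x) v w
  map_smul' c v := by ext f x; exact map_smul (fderiv ℝ f.1 x) c v

theorem pd_apply (v : E) (f : smoothFun E) (x : E) : (pd v f).1 x = fderiv ℝ f.1 x v := rfl

theorem pd_comm (v w : E) (f : smoothFun E) : pd v (pd w f) = pd w (pd v f) := by
  ext x
  have hs : IsSymmSndFDerivAt ℝ f.1 x :=
    (contDiff_infty.1 (contDiff_coe f) 2).contDiffAt.isSymmSndFDerivAt (by simp)
  have hd : DifferentiableAt ℝ (fderiv ℝ f.1) x :=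
    ((contDiff_coe f).fderiv_right (m := ∞) le_rfl).differentiable (by simp) x
  have key : ∀ a b : E, (pd a (pd b f)).1 x = fderiv ℝ (fderiv ℝ f.1) x a b := by
    intro a b
    change fderiv ℝ (fun y => fderiv ℝ f.1 y b) x a = _
    rw [fderiv_clm_apply hd (differentiableAt_const b)]
    simp
  rw [key, key]
  exact hs.eq v w

/-- The iterated derivative on the diagonal is the iterated directional derivative. -/
theorem iteratedFDeriv_apply_const_eq_pd_pow (f : smoothFun E) (v : E) (k : ℕ) (x : E) :
    iteratedFDeriv ℝ k f.1 x (fun _ => v) = ((pd v ^ k) f).1 x := by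
  induction k generalizing x with
  | zero => simp
  | succ k ih =>
    have hd : DifferentiableAt ℝ (iteratedFDeriv ℝ k f.1) x :=
      (contDiff_coe f).contDiffAt.differentiableAt_iteratedFDeriv
        (by exact_mod_cast ENat.natCast_lt_top k)
    rw [hd.iteratedFDeriv_succ_apply_left', pow_succ', Module.End.mul_apply, pd_apply]
    congr 2
    ext y
    exact ih y

end SmoothFunctions

/-! ### Taylor coefficients of functions vanishing on `W_8` -/

section Jets

/-- Taylor's formula along a curve `τ • u` with `τ` and `u` continuous in a parameter. -/
theorem exists_continuous_taylor_remainder {E : Type*} [NormedAddCommGroup E] [NormedSpace ℝ E]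
    (f : smoothFun E) {u : ℝ → E} {τ : ℝ → ℝ} (hu : Continuous u) (hτ : Continuous τ) (n : ℕ) :
    ∃ R : ℝ → ℝ, Continuous R ∧ ∀ t, f.1 (τ t • u t) =
      ∑ k ∈ Finset.range (n + 1), (k.factorial : ℝ)⁻¹ * ((pd (τ t • u t) ^ k) f).1 0 +
        τ t ^ (n + 1) * R t := by
  have hK : Continuous fun p : ℝ × ℝ => (1 - p.2) ^ n *
      iteratedFDeriv ℝ (n + 1) f.1 (p.2 • τ p.1 • u p.1) (fun _ => u p.1) := by
    have h1 : Continuous (iteratedFDeriv ℝ (n + 1) f.1) :=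
      (contDiff_coe f).continuous_iteratedFDeriv (by exact_mod_cast le_top)
    have h2 : Continuous fun p : ℝ × ℝ => p.2 • τ p.1 • u p.1 :=
      continuous_snd.smul ((hτ.comp continuous_fst).smul (hu.comp continuous_fst))
    have h3 : Continuous fun p : ℝ × ℝ => (fun _ : Fin (n + 1) => u p.1) :=
      continuous_pi fun _ => hu.comp continuous_fst
    exact ((continuous_const.sub continuous_snd).pow n).mul ((h1.comp h2).eval h3)
  refine ⟨fun t => (n.factorial : ℝ)⁻¹ * ∫ s in (0 : ℝ)..1, (1 - s) ^ n *
      iteratedFDeriv ℝ (n + 1) f.1 (s • τ t • u t) (fun _ => u t), continuous_const.mul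
      (intervalIntegral.continuous_parametric_intervalIntegral_of_continuous'
        (f := fun t s => (1 - s) ^ n *
          iteratedFDeriv ℝ (n + 1) f.1 (s • τ t • u t) (fun _ => u t)) hK 0 1), fun t => ?_⟩
  have h := map_add_eq_sum_add_integral_iteratedFDeriv (f := f.1) (x := 0) (y := τ t • u t) (n := n)
    fun s _ => ((contDiff_coe f).of_le (by exact_mod_cast le_top)).contDiffAt
  simp only [zero_add] at h
  rw [h]
  congr 1
  · refine Finset.sum_congr rfl fun k _ => ?_
    rw [iteratedFDeriv_apply_const_eq_pd_pow, smul_eq_mul]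
  · have : ∀ s : ℝ, iteratedFDeriv ℝ (n + 1) f.1 (s • τ t • u t) (fun _ => τ t • u t) =
        τ t ^ (n + 1) * iteratedFDeriv ℝ (n + 1) f.1 (s • τ t • u t) (fun _ => u t) := fun s => by
      rw [ContinuousMultilinearMap.map_smul_univ _ (fun _ => τ t)]
      simp
    simp only [this, smul_eq_mul]
    rw [mul_left_comm (τ t ^ (n + 1)), ← intervalIntegral.integral_const_mul (τ t ^ (n + 1))]
    simp only [mul_left_comm]

/-- The Taylor polynomial of order three in three commuting derivations. -/
theorem taylor_sum_of_commute {M : Type*} [AddCommGroup M] [Module ℝ M] (P Q S : Module.End ℝ M)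
    (hQP : ∀ g, Q (P g) = P (Q g)) (hSP : ∀ g, S (P g) = P (S g)) (hSQ : ∀ g, S (Q g) = Q (S g))
    (ev : M →ₗ[ℝ] ℝ) (f : M) (a b c : ℝ) :
    ∑ k ∈ Finset.range 4, (k.factorial : ℝ)⁻¹ * ev (((a • P + b • Q + c • S) ^ k) f) =
      ev f + (a * ev (P f) + b * ev (Q f) + c * ev (S f)) +
      (a ^ 2 * ev (P (P f)) + b ^ 2 * ev (Q (Q f)) + c ^ 2 * ev (S (S f)) +
        2 * a * b * ev (P (Q f)) + 2 * a * c * ev (P (S f)) + 2 * b * c * ev (Q (S f))) / 2 +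
      (a ^ 3 * ev (P (P (P f))) + b ^ 3 * ev (Q (Q (Q f))) + c ^ 3 * ev (S (S (S f))) +
        3 * a ^ 2 * b * ev (P (P (Q f))) + 3 * a ^ 2 * c * ev (P (P (S f))) +
        3 * a * b ^ 2 * ev (P (Q (Q f))) + 3 * b ^ 2 * c * ev (Q (Q (S f))) +
        3 * a * c ^ 2 * ev (P (S (S f))) + 3 * b * c ^ 2 * ev (Q (S (S f))) +
        6 * a * b * c * ev (P (Q (S f)))) / 6 := by
  simp only [Finset.sum_range_succ, Finset.sum_range_zero, pow_succ, pow_zero, one_mul,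
    Module.End.mul_apply, Module.End.one_apply, LinearMap.add_apply,
    LinearMap.smul_apply, map_add, map_smul, hQP, hSP, hSQ, smul_eq_mul]
  norm_num [Nat.factorial]
  ring

variable {n : ℕ} (hn : 2 ≤ n)

theorem ix_injective : Function.Injective (ix hn) := Fin.castLE_injective (by omega)

/-- The coordinate vector `∂/∂x_{k+1}`, `k = 0, 1, 2`. -/
def ex (k : Fin 3) : Fin (2 * n) → ℝ := Pi.single (ix hn k) 1

theorem ex_apply_ix (k l : Fin 3) : ex hn k (ix hn l) = if l = k then 1 else 0 := by
  simp [ex, Pi.single_apply, (ix_injective hn).eq_iff]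

theorem ex_apply_of_three_le (k : Fin 3) {j : Fin (2 * n)} (hj : 3 ≤ (j : ℕ)) :
    ex hn k j = 0 := by
  rw [ex, Pi.single_apply, if_neg]
  rintro rfl
  have : ((ix hn k : Fin (2 * n)) : ℕ) = k := rfl
  omega

/-- The curve `t ↦ (t⁶, t⁵, -t⁴, 0, …, 0)` runs in `W_8`. Splitting off the factor `t⁴` turns a
Taylor remainder of order four into one of order `t ^ 16`. -/
theorem curve_mem_W8 (t : ℝ) :
    t ^ 4 • (t ^ 2 • ex hn 0 + t • ex hn 1 - ex hn 2) ∈ W8 hn := by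
  refine ⟨?_, ?_, fun j hj => ?_⟩
  · simp [ex_apply_ix]; ring
  · simp [ex_apply_ix]; ring
  · simp [ex_apply_of_three_le hn _ hj]

/-- The relations between the Taylor coefficients at `0`, up to order three, of a smooth function
that vanishes on `W_8`. -/
theorem jet_of_vanishing {f : smoothFun (Fin (2 * n) → ℝ)}
    (hf : ∀ᶠ x in 𝓝 (0 : Fin (2 * n) → ℝ), x ∈ W8 hn → f.1 x = 0) :
    let P := fun k => pd (ex hn k)
    (f.1 0 = 0 ∧ (P 0 f).1 0 = 0 ∧ (P 1 f).1 0 = 0 ∧ (P 2 f).1 0 = 0) ∧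
    ((P 2 (P 2 f)).1 0 = 0 ∧ (P 1 (P 2 f)).1 0 = 0 ∧ (P 0 (P 1 f)).1 0 = 0 ∧
      (P 1 (P 1 f)).1 0 = 2 * (P 0 (P 2 f)).1 0) ∧
    3 * (P 0 (P 0 f)).1 0 = (P 2 (P 2 (P 2 f))).1 0 ∧
    (P 1 (P 2 (P 2 f))).1 0 = 0 ∧
    (P 0 (P 2 (P 2 f))).1 0 = (P 1 (P 1 (P 2 f))).1 0 ∧
    (P 1 (P 1 (P 1 f))).1 0 = 6 * (P 0 (P 1 (P 2 f))).1 0 := by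
  intro P
  have hu : Continuous fun t : ℝ => t ^ 2 • ex hn 0 + t • ex hn 1 - ex hn 2 := by fun_prop
  have hτ : Continuous fun t : ℝ => t ^ 4 := by fun_prop
  obtain ⟨R, hR, hT⟩ := exists_continuous_taylor_remainder f hu hτ 3
  have hγ : Tendsto (fun t : ℝ => t ^ 4 • (t ^ 2 • ex hn 0 + t • ex hn 1 - ex hn 2))
      (𝓝 0) (𝓝 0) := by
    have h := (hτ.smul hu).tendsto 0
    simp only [Pi.smul_apply', ne_eq, OfNat.ofNat_ne_zero, not_false_eq_true, zero_pow,
      zero_smul] at h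
    exact h
  have hpd : ∀ t : ℝ, pd (t ^ 4 • (t ^ 2 • ex hn 0 + t • ex hn 1 - ex hn 2)) =
      t ^ 6 • P 0 + t ^ 5 • P 1 - t ^ 4 • P 2 := fun t => by
    simp only [map_smul, map_add, map_sub, P, smul_sub, smul_add, smul_smul]
    ring_nf
  have hcomm : ∀ i j g, P i (P j g) = P j (P i g) := fun i j g => pd_comm _ _ g
  let ev : smoothFun (Fin (2 * n) → ℝ) →ₗ[ℝ] ℝ :=
    ⟨⟨fun g => g.1 0, fun _ _ => rfl⟩, fun _ _ => rfl⟩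
  have hev : ∀ g, ev g = g.1 0 := fun _ => rfl
  -- the terms of degree less than 16 of the Taylor polynomial along the curve
  let p : Polynomial ℝ := Polynomial.C (f.1 0) - Polynomial.monomial 4 ((P 2 f).1 0) +
    Polynomial.monomial 5 ((P 1 f).1 0) + Polynomial.monomial 6 ((P 0 f).1 0) +
    Polynomial.monomial 8 ((P 2 (P 2 f)).1 0 / 2) - Polynomial.monomial 9 ((P 1 (P 2 f)).1 0) +
    Polynomial.monomial 10 ((P 1 (P 1 f)).1 0 / 2 - (P 0 (P 2 f)).1 0) +
    Polynomial.monomial 11 ((P 0 (P 1 f)).1 0) +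
    Polynomial.monomial 12 ((P 0 (P 0 f)).1 0 / 2 - (P 2 (P 2 (P 2 f))).1 0 / 6) +
    Polynomial.monomial 13 ((P 1 (P 2 (P 2 f))).1 0 / 2) +
    Polynomial.monomial 14 ((P 0 (P 2 (P 2 f))).1 0 / 2 - (P 1 (P 1 (P 2 f))).1 0 / 2) +
    Polynomial.monomial 15 ((P 1 (P 1 (P 1 f))).1 0 / 6 - (P 0 (P 1 (P 2 f))).1 0)
  -- the remaining terms, of degrees 16, 17 and 18, join the remainder
  obtain ⟨q, hq⟩ : ∃ q : ℝ → ℝ, Continuous q ∧ ∀ t : ℝ,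
      f.1 (t ^ 4 • (t ^ 2 • ex hn 0 + t • ex hn 1 - ex hn 2)) = p.eval t + t ^ 16 * q t := by
    refine ⟨fun t => ((P 0 (P 0 (P 0 f))).1 0 * t ^ 2 + 3 * (P 0 (P 0 (P 1 f))).1 0 * t -
      3 * (P 0 (P 0 (P 2 f))).1 0 + 3 * (P 0 (P 1 (P 1 f))).1 0) / 6 + R t, by fun_prop,
      fun t => ?_⟩
    rw [hT t, hpd t]
    have key := taylor_sum_of_commute (P 0) (P 1) (P 2) (hcomm 1 0) (hcomm 2 0) (hcomm 2 1) ev f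
      (t ^ 6) (t ^ 5) (-t ^ 4)
    rw [neg_smul (t ^ 4) (P 2), ← sub_eq_add_neg] at key
    rw [show (∑ k ∈ Finset.range (3 + 1), (k.factorial : ℝ)⁻¹ *
      (((t ^ 6 • P 0 + t ^ 5 • P 1 - t ^ 4 • P 2) ^ k) f).1 0) = _ from key]
    simp only [p, Polynomial.eval_add, Polynomial.eval_sub, Polynomial.eval_C,
      Polynomial.eval_monomial, hev]
    ring
  have hc := coeff_eq_zero_of_eventually_eval_eq (n := 16) (p := p) (R := fun t => - q t)
    hq.1.neg.continuousAt (by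
      filter_upwards [hγ.eventually hf] with t ht
      have := ht (curve_mem_W8 hn t)
      rw [hq.2] at this
      linear_combination this)
  have h0 := hc 0 (by norm_num)
  have h4 := hc 4 (by norm_num)
  have h5 := hc 5 (by norm_num)
  have h6 := hc 6 (by norm_num)
  have h8 := hc 8 (by norm_num)
  have h9 := hc 9 (by norm_num)
  have h10 := hc 10 (by norm_num)
  have h11 := hc 11 (by norm_num)
  have h12 := hc 12 (by norm_num)
  have h13 := hc 13 (by norm_num)
  have h14 := hc 14 (by norm_num)
  have h15 := hc 15 (by norm_num)
  simp [p, Polynomial.coeff_monomial, Polynomial.coeff_C]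
    at h0 h4 h5 h6 h8 h9 h10 h11 h12 h13 h14 h15
  refine ⟨⟨h0, h6, h5, h4⟩, ⟨h8, h9, h11, ?_⟩, ?_, h13, ?_, ?_⟩ <;> linarith

end Jets

/-! ### Germs of forms and their algebraic restrictions -/

section FormGerms

variable {E : Type*} [NormedAddCommGroup E] [NormedSpace ℝ E]

/-- The germ at `0` of a form that is smooth everywhere. -/
def ofSmooth {p : ℕ} (σ : E → E [⋀^Fin p]→L[ℝ] ℝ) (hσ : ContDiff ℝ ∞ σ) : FormGerm E p :=
  FormGerm.mk σ (Eventually.of_forall fun _ => hσ.contDiffAt)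

variable {p : ℕ} {σ η : E → E [⋀^Fin p]→L[ℝ] ℝ}

theorem ofSmooth_eq_iff {hσ : ContDiff ℝ ∞ σ} {hη : ContDiff ℝ ∞ η} :
    ofSmooth σ hσ = ofSmooth η hη ↔ σ =ᶠ[𝓝 0] η :=
  Subtype.ext_iff.trans Germ.coe_eq

theorem ofSmooth_add (hσ : ContDiff ℝ ∞ σ) (hη : ContDiff ℝ ∞ η) :
    ofSmooth σ hσ + ofSmooth η hη = ofSmooth (fun x => σ x + η x) (hσ.add hη) := rfl

theorem ofSmooth_smul (c : ℝ) (hσ : ContDiff ℝ ∞ σ) :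
    c • ofSmooth σ hσ = ofSmooth (fun x => c • σ x) (hσ.const_smul c) := rfl

theorem ofSmooth_sum {ι : Type*} (s : Finset ι) {σ : ι → E → E [⋀^Fin p]→L[ℝ] ℝ}
    (hσ : ∀ i, ContDiff ℝ ∞ (σ i)) :
    ∑ i ∈ s, ofSmooth (σ i) (hσ i) =
      ofSmooth (fun x => ∑ i ∈ s, σ i x) (ContDiff.sum fun i _ => hσ i) := by
  classical
  induction s using Finset.induction_on with
  | empty => rfl
  | insert a s ha ih =>
    rw [Finset.sum_insert ha, ih, ofSmooth_add, ofSmooth_eq_iff]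
    exact Eventually.of_forall fun x => (Finset.sum_insert (f := fun i => σ i x) ha).symm

theorem contDiff_extDeriv (hσ : ContDiff ℝ ∞ σ) : ContDiff ℝ ∞ (extDeriv σ) :=
  contDiff_iff_contDiffAt.2 fun _ => contDiffAt_extDeriv hσ.contDiffAt

theorem d_ofSmooth (hσ : ContDiff ℝ ∞ σ) :
    d p (ofSmooth σ hσ) = ofSmooth (extDeriv σ) (contDiff_extDeriv hσ) := rfl

theorem d_d (g : FormGerm E p) : d (p + 1) (d p g) = 0 := by
  obtain ⟨_, σ, hσ, rfl⟩ := g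
  refine Subtype.ext (Germ.coe_eq.2 ?_)
  filter_upwards [hσ] with x hx
  exact extDeriv_extDeriv_apply hx (by
    simp only [minSmoothness_of_isRCLikeNormedField]; exact WithTop.coe_le_coe.2 le_top)

theorem exists_eq_ofSmooth [FiniteDimensional ℝ E] (g : FormGerm E p) :
    ∃ (σ : E → E [⋀^Fin p]→L[ℝ] ℝ) (hσ : ContDiff ℝ ∞ σ), g = ofSmooth σ hσ := by
  obtain ⟨_, σ, hσ, rfl⟩ := g
  obtain ⟨τ, hτ, h⟩ := exists_contDiff_eventuallyEq hσ
  exact ⟨τ, hτ, Subtype.ext (Germ.coe_eq.2 h)⟩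

theorem ofSmooth_mem_vanishingForms {N : Set E} {hσ : ContDiff ℝ ∞ σ} :
    ofSmooth σ hσ ∈ vanishingForms N p ↔ ∀ᶠ x in 𝓝 (0 : E), x ∈ N → σ x = 0 := by
  refine ⟨?_, fun h => ⟨σ, rfl, h⟩⟩
  rintro ⟨η, h, hη⟩
  filter_upwards [Germ.coe_eq.1 h, hη] with x h1 h2 hx
  exact h1.trans (h2 hx)

/-- The form `h ξ` for a function `h` and a linear form `ξ`. -/
def smulOneForm (h : E → ℝ) (ξ : E →L[ℝ] ℝ) (x : E) : E [⋀^Fin 1]→L[ℝ] ℝ :=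
  h x • ContinuousAlternatingMap.ofSubsingleton ℝ E ℝ (0 : Fin 1) ξ

theorem contDiff_smulOneForm {h : E → ℝ} (hh : ContDiff ℝ ∞ h) (ξ : E →L[ℝ] ℝ) :
    ContDiff ℝ ∞ (smulOneForm h ξ) :=
  hh.smul contDiff_const

theorem extDeriv_smulOneForm {h : E → ℝ} {x : E} (hh : DifferentiableAt ℝ h x) (ξ : E →L[ℝ] ℝ) :
    extDeriv (smulOneForm h ξ) x = wedge (fderiv ℝ h x) ξ := by
  ext v
  have hd : DifferentiableAt ℝ (smulOneForm h ξ) x := hh.smul (differentiableAt_const _)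
  have key : ∀ u w : E, fderiv ℝ (fun y => h y * ξ w) x u = fderiv ℝ h x u * ξ w := fun u w => by
    rw [fderiv_mul_const hh]
    simp [mul_comm]
  rw [extDeriv_apply hd, Fin.sum_univ_two, wedge_apply]
  simp only [smulOneForm, ContinuousAlternatingMap.smul_apply, smul_eq_mul,
    ContinuousAlternatingMap.ofSubsingleton_apply_apply, key]
  simp [Fin.removeNth]
  ring

theorem extDeriv_apply_two {β : E → E [⋀^Fin 1]→L[ℝ] ℝ} {x : E} (hβ : DifferentiableAt ℝ β x)
    (u v : E) : extDeriv β x ![u, v] =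
      fderiv ℝ (fun y => β y ![v]) x u - fderiv ℝ (fun y => β y ![u]) x v := by
  have h0 : Fin.removeNth (0 : Fin 2) ![u, v] = ![v] := by ext i; fin_cases i; rfl
  have h1 : Fin.removeNth (1 : Fin 2) ![u, v] = ![u] := by ext i; fin_cases i; rfl
  rw [extDeriv_apply hβ, Fin.sum_univ_two, h0, h1]
  simp [sub_eq_add_neg]

theorem extDeriv_apply_three {σ : E → E [⋀^Fin 2]→L[ℝ] ℝ} {x : E} (hσ : DifferentiableAt ℝ σ x)
    (u v w : E) : extDeriv σ x ![u, v, w] =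
      fderiv ℝ (fun y => σ y ![v, w]) x u - fderiv ℝ (fun y => σ y ![u, w]) x v +
        fderiv ℝ (fun y => σ y ![u, v]) x w := by
  have h0 : Fin.removeNth (0 : Fin 3) ![u, v, w] = ![v, w] := by ext i; fin_cases i <;> rfl
  have h1 : Fin.removeNth (1 : Fin 3) ![u, v, w] = ![u, w] := by ext i; fin_cases i <;> rfl
  have h2 : Fin.removeNth (2 : Fin 3) ![u, v, w] = ![u, v] := by ext i; fin_cases i <;> rfl
  rw [extDeriv_apply hσ, Fin.sum_univ_three, h0, h1, h2]
  simp [sub_eq_add_neg]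

theorem contDiff_apply_vec {σ : E → E [⋀^Fin p]→L[ℝ] ℝ} (hσ : ContDiff ℝ ∞ σ) (v : Fin p → E) :
    ContDiff ℝ ∞ fun x => σ x v :=
  (ContinuousAlternatingMap.apply ℝ E ℝ v).contDiff.comp hσ

/-- The function `x ↦ σ(x)(v_1, …, v_p)`. -/
def component (σ : E → E [⋀^Fin p]→L[ℝ] ℝ) (hσ : ContDiff ℝ ∞ σ) (v : Fin p → E) : smoothFun E :=
  ⟨fun x => σ x v, contDiff_apply_vec hσ v⟩

theorem pd_eventuallyEq {f g : smoothFun E} (h : f.1 =ᶠ[𝓝 0] g.1) (v : E) :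
    (pd v f).1 =ᶠ[𝓝 0] (pd v g).1 :=
  h.fderiv.mono fun x hx => by rw [pd_apply, pd_apply, hx]

/-- The components of a 2-form with zero algebraic restriction to `N`. -/
theorem exists_components_of_mem_zeroAlgRestr [FiniteDimensional ℝ E] {N : Set E}
    {σ : E → E [⋀^Fin 2]→L[ℝ] ℝ} {hσ : ContDiff ℝ ∞ σ} (h : ofSmooth σ hσ ∈ zeroAlgRestr N) :
    ∃ (α : E → E → smoothFun E) (β : E → smoothFun E),
      (∀ u v, ∀ᶠ x in 𝓝 (0 : E), x ∈ N → (α u v).1 x = 0) ∧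
      (∀ v, ∀ᶠ x in 𝓝 (0 : E), x ∈ N → (β v).1 x = 0) ∧
      ∀ u v, (component σ hσ ![u, v]).1 =ᶠ[𝓝 0] (α u v + pd u (β v) - pd v (β u)).1 := by
  obtain ⟨a, ha, _, ⟨b, hb, rfl⟩, hab⟩ := Submodule.mem_sup.1 h
  obtain ⟨α, hα, rfl⟩ := exists_eq_ofSmooth a
  obtain ⟨β, hβ, rfl⟩ := exists_eq_ofSmooth b
  rw [ofSmooth_mem_vanishingForms] at ha
  rw [SetLike.mem_coe, ofSmooth_mem_vanishingForms] at hb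
  rw [d_ofSmooth, ofSmooth_add, ofSmooth_eq_iff] at hab
  refine ⟨fun u v => component α hα ![u, v], fun v => component β hβ ![v], fun u v => ?_,
    fun v => ?_, fun u v => ?_⟩
  · filter_upwards [ha] with x hx hN
    simp [component, hx hN]
  · filter_upwards [hb] with x hx hN
    simp [component, hx hN]
  · filter_upwards [hab] with x hx
    change σ x ![u, v] = α x ![u, v] + fderiv ℝ (fun y => β y ![v]) x u -
      fderiv ℝ (fun y => β y ![u]) x v
    rw [← hx, ContinuousAlternatingMap.add_apply,
      extDeriv_apply_two (hβ.differentiable (by simp) x), add_sub_assoc]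

theorem contDiff_smul_wedge (f : smoothFun E) (a b : E →L[ℝ] ℝ) :
    ContDiff ℝ ∞ fun x => f.1 x • wedge a b :=
  (contDiff_coe f).smul contDiff_const

/-- The algebraic restriction of `f a ∧ b`, as a linear function of `f`. -/
def wedgeRestr (N : Set E) (a b : E →L[ℝ] ℝ) : smoothFun E →ₗ[ℝ] AlgRestr N where
  toFun f := algRestr N (ofSmooth _ (contDiff_smul_wedge f a b))
  map_add' f g := by
    rw [← map_add, ofSmooth_add]
    congr 1
    rw [ofSmooth_eq_iff]
    exact Eventually.of_forall fun x => add_smul (f.1 x) (g.1 x) _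
  map_smul' c f := by
    rw [RingHom.id_apply, ← map_smul, ofSmooth_smul]
    congr 1
    rw [ofSmooth_eq_iff]
    exact Eventually.of_forall fun x => mul_smul c (f.1 x) _

variable {N : Set E}

theorem wedgeRestr_apply (a b : E →L[ℝ] ℝ) (f : smoothFun E) :
    wedgeRestr N a b f = algRestr N (ofSmooth _ (contDiff_smul_wedge f a b)) := rfl

theorem wedgeRestr_swap (a b : E →L[ℝ] ℝ) (f : smoothFun E) :
    wedgeRestr N a b f = - wedgeRestr N b a f := by
  rw [← neg_one_smul ℝ (wedgeRestr N b a f), wedgeRestr_apply, wedgeRestr_apply, ← map_smul,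
    ofSmooth_smul]
  congr 1
  rw [ofSmooth_eq_iff]
  refine Eventually.of_forall fun x => ?_
  ext v
  simp [wedge_apply]
  ring

theorem wedgeRestr_self (a : E →L[ℝ] ℝ) (f : smoothFun E) : wedgeRestr N a a f = 0 := by
  have h := wedgeRestr_swap (N := N) a a f
  have h2 : (2 : ℝ) • wedgeRestr N a a f = 0 := by
    rw [two_smul]
    exact add_eq_zero_iff_eq_neg.2 h
  exact (smul_eq_zero.1 h2).resolve_left two_ne_zero

theorem algRestr_eq_zero_iff {g : FormGerm E 2} : algRestr N g = 0 ↔ g ∈ zeroAlgRestr N :=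
  Submodule.Quotient.mk_eq_zero _

theorem wedgeRestr_eq_zero {f : smoothFun E} (hf : ∀ᶠ x in 𝓝 (0 : E), x ∈ N → f.1 x = 0)
    (a b : E →L[ℝ] ℝ) : wedgeRestr N a b f = 0 := by
  refine algRestr_eq_zero_iff.2 (Submodule.mem_sup_left (ofSmooth_mem_vanishingForms.2 ?_))
  filter_upwards [hf] with x hx hN
  rw [hx hN, zero_smul]

/-- If `f` vanishes on `N`, then `g df ∧ ξ = d(f g ξ) - f dg ∧ ξ` has zero algebraic restriction
to `N`. -/
theorem sum_wedgeRestr_eq_zero {ι : Type*} (s : Finset ι) {f : smoothFun E}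
    (hf : ∀ᶠ x in 𝓝 (0 : E), x ∈ N → f.1 x = 0) {a : ι → E →L[ℝ] ℝ} {q : ι → smoothFun E}
    (hd : ∀ x, fderiv ℝ f.1 x = ∑ i ∈ s, (q i).1 x • a i) (ξ : E →L[ℝ] ℝ) (g : smoothFun E) :
    ∑ i ∈ s, wedgeRestr N (a i) ξ (q i * g) = 0 := by
  have hfg : ContDiff ℝ ∞ fun x => f.1 x * g.1 x := (contDiff_coe f).mul (contDiff_coe g)
  have hdg : ContDiff ℝ ∞ fun x => f.1 x • extDeriv (smulOneForm g.1 ξ) x :=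
    (contDiff_coe f).smul (contDiff_extDeriv (contDiff_smulOneForm (contDiff_coe g) ξ))
  simp only [wedgeRestr_apply]
  rw [← map_sum, ofSmooth_sum, algRestr_eq_zero_iff]
  have key : ofSmooth (fun x => ∑ i ∈ s, (q i * g).1 x • wedge (a i) ξ)
      (ContDiff.sum fun i _ => contDiff_smul_wedge (q i * g) (a i) ξ) =
      (-1 : ℝ) • ofSmooth _ hdg + d 1 (ofSmooth _ (contDiff_smulOneForm hfg ξ)) := by
    rw [d_ofSmooth, ofSmooth_smul, ofSmooth_add, ofSmooth_eq_iff]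
    refine Eventually.of_forall fun x => ?_
    have hfx : DifferentiableAt ℝ f.1 x := (contDiff_coe f).differentiable (by simp) x
    have hgx : DifferentiableAt ℝ g.1 x := (contDiff_coe g).differentiable (by simp) x
    simp only
    rw [extDeriv_smulOneForm hgx, extDeriv_smulOneForm (hfx.fun_mul hgx), fderiv_fun_mul hfx hgx,
      hd x]
    change _ = (-1 : ℝ) • f.1 x • wedge (fderiv ℝ g.1 x) ξ +
      wedge (f.1 x • fderiv ℝ g.1 x + g.1 x • ∑ i ∈ s, (q i).1 x • a i) ξ
    ext v
    simp only [ContinuousAlternatingMap.sum_apply, ContinuousAlternatingMap.smul_apply,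
      ContinuousAlternatingMap.add_apply, wedge_apply, _root_.add_apply,
      _root_.smul_apply, _root_.sum_apply, smul_eq_mul]
    have h1 : ∀ i ∈ s, (q i * g).1 x * (a i (v 0) * ξ (v 1) - a i (v 1) * ξ (v 0)) =
        g.1 x * ξ (v 1) * ((q i).1 x * a i (v 0)) - g.1 x * ξ (v 0) * ((q i).1 x * a i (v 1)) :=
      fun i _ => by
        rw [show (q i * g).1 x = (q i).1 x * g.1 x from rfl]
        ring
    rw [Finset.sum_congr rfl h1, Finset.sum_sub_distrib, ← Finset.mul_sum, ← Finset.mul_sum]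
    ring
  rw [key]
  refine Submodule.add_mem_sup (Submodule.smul_mem _ _ (ofSmooth_mem_vanishingForms.2 ?_))
    (Submodule.mem_map_of_mem (ofSmooth_mem_vanishingForms.2 ?_))
  · filter_upwards [hf] with x hx hN
    rw [hx hN, zero_smul]
  · filter_upwards [hf] with x hx hN
    rw [smulOneForm, hx hN, zero_mul, zero_smul]

end FormGerms

/-! ### Smooth functions and 2-forms in coordinates -/

section Coordinates

/-- The coordinate functions of `ℝ^m`. -/
def coord {m : ℕ} (j : Fin m) : smoothFun (Fin m → ℝ) :=
  ⟨fun x => x j, (contDiff_apply ℝ ℝ j : ContDiff ℝ ∞ _)⟩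

theorem coord_apply {m : ℕ} (j : Fin m) (x : Fin m → ℝ) : (coord j).1 x = x j := rfl

variable {E : Type*} [NormedAddCommGroup E] [NormedSpace ℝ E]

theorem pd_mul (v : E) (f g : smoothFun E) : pd v (f * g) = f * pd v g + g * pd v f := by
  ext x
  have hf : DifferentiableAt ℝ f.1 x := (contDiff_coe f).differentiable (by simp) x
  have hg : DifferentiableAt ℝ g.1 x := (contDiff_coe g).differentiable (by simp) x
  change fderiv ℝ (f.1 * g.1) x v = f.1 x * fderiv ℝ g.1 x v + g.1 x * fderiv ℝ f.1 x v
  rw [fderiv_mul hf hg]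
  rfl

theorem pd_one (v : E) : pd v (1 : smoothFun E) = 0 := by
  ext x
  change fderiv ℝ (fun _ : E => (1 : ℝ)) x v = 0
  simp

theorem pd_coord {m : ℕ} (v : Fin m → ℝ) (j : Fin m) : pd v (coord j) = v j • 1 := by
  ext x
  change fderiv ℝ (ContinuousLinearMap.proj (R := ℝ) (φ := fun _ : Fin m => ℝ) j) x v = v j * 1
  rw [ContinuousLinearMap.fderiv]
  simp

/-- Hadamard's lemma in coordinates. -/
theorem exists_hadamard {m : ℕ} (f : smoothFun (Fin m → ℝ)) :
    ∃ g : Fin m → smoothFun (Fin m → ℝ), f = f.1 0 • 1 + ∑ j, coord j * g j := by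
  obtain ⟨g, hg, h⟩ := exists_contDiff_hadamard (contDiff_coe f)
  refine ⟨fun j => ⟨fun x => g x (Pi.single j 1), hg.clm_apply contDiff_const⟩, ?_⟩
  ext x
  have hsum : ∀ s : Finset (Fin m), (∑ j ∈ s, coord j *
      (⟨fun x => g x (Pi.single j 1), hg.clm_apply contDiff_const⟩ :
        smoothFun (Fin m → ℝ))).1 x = ∑ j ∈ s, x j * g x (Pi.single j 1) := fun s => by
    rw [AddSubmonoidClass.coe_finsetSum, Finset.sum_apply]
    rfl
  change f.1 x = f.1 0 * 1 + _
  rw [h x, hsum, mul_one]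
  congr 1
  calc g x x = g x (∑ j, x j • Pi.single j (1 : ℝ)) := by rw [← pi_eq_sum_univ' x]
    _ = _ := by simp only [map_sum, map_smul, smul_eq_mul]

theorem apply_swap (η : E [⋀^Fin 2]→L[ℝ] ℝ) (u v : E) : η ![v, u] = - η ![u, v] := by
  have h := η.toAlternatingMap.map_swap ![u, v] (zero_ne_one : (0 : Fin 2) ≠ 1)
  rw [show ![u, v] ∘ Equiv.swap (0 : Fin 2) 1 = ![v, u] by ext1 i; fin_cases i <;> simp] at h
  exact h

/-- A 2-form on `ℝ^m` in coordinates. -/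
theorem eq_sum_smul_wedge {m : ℕ} (η : (Fin m → ℝ) [⋀^Fin 2]→L[ℝ] ℝ) :
    η = ∑ i, ∑ j, (2⁻¹ * η ![Pi.single i 1, Pi.single j 1]) •
      wedge (ContinuousLinearMap.proj i) (ContinuousLinearMap.proj j) := by
  apply ContinuousAlternatingMap.toAlternatingMap_injective
  refine Module.Basis.ext_alternating (Pi.basisFun ℝ (Fin m)) fun v _ => ?_
  have hv : (fun i => Pi.basisFun ℝ (Fin m) (v i)) =
      ![Pi.single (v 0) 1, Pi.single (v 1) 1] := by
    ext i
    fin_cases i <;> simp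
  rw [hv]
  simp only [ContinuousAlternatingMap.coe_toAlternatingMap, ContinuousAlternatingMap.sum_apply,
    ContinuousAlternatingMap.smul_apply, wedge_apply, ContinuousLinearMap.proj_apply, smul_eq_mul,
    Matrix.cons_val_zero, Matrix.cons_val_one, Pi.single_apply, mul_sub, Finset.sum_sub_distrib,
    mul_ite, mul_one, mul_zero, Finset.sum_ite_eq',
    Finset.mem_univ, if_true]
  rw [apply_swap η (Pi.single (v 0) 1)]
  ring

end Coordinates

/-! ### Generators of the algebraic restrictions to `W_8` -/

section Generation

/-- The module of Kähler 2-forms of `W_8` is generated, as a vector space, by nine elements. Here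
`A`, `B`, `D` stand for `f ↦ [f dx_2 ∧ dx_3]`, `[f dx_1 ∧ dx_3]`, `[f dx_1 ∧ dx_2]`, and `X`, `Y`,
`Z` for the coordinates `x_1`, `x_2`, `x_3`. -/
theorem mem_of_relations {C M : Type*} [CommRing C] [Algebra ℝ C] [AddCommGroup M] [Module ℝ M]
    (A B D : C →ₗ[ℝ] M) (X Y Z : C) (S : Submodule ℝ M)
    (hadamard : ∀ g : C, ∃ (c : ℝ) (g₁ g₂ g₃ : C), ∀ h : C,
      A (h * g) = c • A h + A (h * X * g₁) + A (h * Y * g₂) + A (h * Z * g₃) ∧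
      B (h * g) = c • B h + B (h * X * g₁) + B (h * Y * g₂) + B (h * Z * g₃) ∧
      D (h * g) = c • D h + D (h * X * g₁) + D (h * Y * g₂) + D (h * Z * g₃))
    (hBZZ : ∀ g, B (Z ^ 2 * g) = 0) (hBX : ∀ g, B (X * g) = 0)
    (hDX : ∀ g, (2 : ℝ) • D (X * g) = (3 : ℝ) • A (Z ^ 2 * g))
    (hDY : ∀ g, D (Y * g) = 0) (hDZ : ∀ g, D (Z * g) = A (X * g))
    (hBZ : ∀ g, B (Z * g) = (-2 : ℝ) • A (Y * g))
    (hA₁ : ∀ g, A ((X ^ 2 + Z ^ 3) * g) = 0) (hA₂ : ∀ g, A ((Y ^ 2 + X * Z) * g) = 0)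
    (hB₂ : ∀ g, B ((Y ^ 2 + X * Z) * g) = 0)
    (s₁ : A 1 ∈ S) (s₂ : B 1 ∈ S) (s₃ : D 1 ∈ S) (s₄ : A Z ∈ S) (s₅ : A Y ∈ S) (s₆ : A X ∈ S)
    (s₆' : B Y ∈ S) (s₇ : A (Z ^ 2) ∈ S) (s₈ : A (Y ^ 2) ∈ S) :
    (∀ g, A g ∈ S) ∧ (∀ g, B g ∈ S) ∧ ∀ g, D g ∈ S := by
  -- multiples of `XY`, `YZ`, `X²`, `Z³` are killed by `A`, those of `Y²` by `B`, and `A` does not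
  -- distinguish `XZ g` from `-Y² g`
  have a_xy : ∀ g, A (X * Y * g) = 0 := fun g => by
    rw [mul_assoc, ← hDZ, mul_left_comm, hDY]
  have a_yz : ∀ g, A (Y * Z * g) = 0 := fun g => by
    have h := hBZ (Z * g)
    rw [← mul_assoc, ← pow_two, hBZZ, ← mul_assoc, eq_comm] at h
    exact (smul_eq_zero.1 h).resolve_left (by norm_num)
  have a_sum : ∀ g, A (X * X * g) + A (Z * Z * Z * g) = 0 := fun g => by
    rw [← map_add, ← hA₁ g]; congr 1; ring
  have a_zzz : ∀ g, A (Z * Z * Z * g) = 0 := fun g => by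
    have h := hDX (Z * g)
    rw [mul_left_comm, hDZ, ← mul_assoc X, eq_neg_of_add_eq_zero_left (a_sum g),
      show Z ^ 2 * (Z * g) = Z * Z * Z * g by ring] at h
    have h5 : (5 : ℝ) • A (Z * Z * Z * g) = 0 := by linear_combination (norm := module) -h
    exact (smul_eq_zero.1 h5).resolve_left (by norm_num)
  have a_xx : ∀ g, A (X * X * g) = 0 := fun g => by
    have h := a_sum g
    rwa [a_zzz, add_zero] at h
  have a_xz : ∀ g, A (X * Z * g) = - A (Y ^ 2 * g) := fun g => by
    rw [eq_neg_iff_add_eq_zero, ← map_add, ← hA₂ g]; congr 1; ring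
  have b_yy : ∀ g, B (Y * Y * g) = 0 := fun g => by
    have h := hB₂ g
    rw [add_mul, map_add, mul_assoc X, hBX, add_zero, pow_two] at h
    exact h
  -- a Hadamard expansion of `g` now decides each case, starting from the highest degree
  have m_yy : ∀ g, A (Y ^ 2 * g) ∈ S := fun g => by
    obtain ⟨c, g₁, g₂, g₃, h⟩ := hadamard g
    have h1 : A (Y ^ 2 * X * g₁) = 0 := by
      rw [show Y ^ 2 * X * g₁ = X * Y * (Y * g₁) by ring, a_xy]
    have h2 : A (Y ^ 2 * Y * g₂) = 0 := by
      have h := a_xz (Y * g₂)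
      rw [show X * Z * (Y * g₂) = X * Y * (Z * g₂) by ring, a_xy,
        show Y ^ 2 * (Y * g₂) = Y ^ 2 * Y * g₂ by ring] at h
      exact neg_eq_zero.1 h.symm
    have h3 : A (Y ^ 2 * Z * g₃) = 0 := by
      rw [show Y ^ 2 * Z * g₃ = Y * Z * (Y * g₃) by ring, a_yz]
    rw [(h _).1, h1, h2, h3]
    simpa using S.smul_mem c s₈
  have m_zz : ∀ g, A (Z ^ 2 * g) ∈ S := fun g => by
    obtain ⟨c, g₁, g₂, g₃, h⟩ := hadamard g
    have h1 : A (Z ^ 2 * X * g₁) = 0 := by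
      rw [show Z ^ 2 * X * g₁ = X * Z * (Z * g₁) by ring, a_xz,
        show Y ^ 2 * (Z * g₁) = Y * Z * (Y * g₁) by ring, a_yz, neg_zero]
    have h2 : A (Z ^ 2 * Y * g₂) = 0 := by
      rw [show Z ^ 2 * Y * g₂ = Y * Z * (Z * g₂) by ring, a_yz]
    have h3 : A (Z ^ 2 * Z * g₃) = 0 := by rw [pow_two, a_zzz]
    rw [(h _).1, h1, h2, h3]
    simpa using S.smul_mem c s₇
  have m_x : ∀ g, A (X * g) ∈ S := fun g => by
    obtain ⟨c, g₁, g₂, g₃, h⟩ := hadamard g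
    rw [(h _).1, a_xx, a_xy, a_xz]
    simpa [sub_eq_add_neg] using S.sub_mem (S.smul_mem c s₆) (m_yy g₃)
  have m_y : ∀ g, A (Y * g) ∈ S := fun g => by
    obtain ⟨c, g₁, g₂, g₃, h⟩ := hadamard g
    rw [(h _).1, mul_comm Y X, a_xy, a_yz, ← pow_two]
    simpa using S.add_mem (S.smul_mem c s₅) (m_yy g₂)
  have m_z : ∀ g, A (Z * g) ∈ S := fun g => by
    obtain ⟨c, g₁, g₂, g₃, h⟩ := hadamard g
    rw [(h _).1, mul_comm Z X, mul_comm Z Y, a_xz, a_yz, ← pow_two]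
    simpa using S.add_mem (S.add_mem (S.smul_mem c s₄) (S.neg_mem (m_yy g₁))) (m_zz g₃)
  have n_y : ∀ g, B (Y * g) ∈ S := fun g => by
    obtain ⟨c, g₁, g₂, g₃, h⟩ := hadamard g
    rw [(h _).2.1, mul_comm Y X, mul_assoc X, hBX, b_yy, mul_comm Y Z, mul_assoc Z, hBZ,
      ← mul_assoc, ← pow_two]
    simpa [sub_eq_add_neg] using S.sub_mem (S.smul_mem c s₆') (S.smul_mem 2 (m_yy g₃))
  refine ⟨fun g => ?_, fun g => ?_, fun g => ?_⟩ <;>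
    obtain ⟨c, g₁, g₂, g₃, h⟩ := hadamard g
  · have h := (h 1).1
    simp only [one_mul] at h
    rw [h]
    exact S.add_mem (S.add_mem (S.add_mem (S.smul_mem c s₁) (m_x g₁)) (m_y g₂)) (m_z g₃)
  · have h := (h 1).2.1
    simp only [one_mul] at h
    rw [h, hBX, hBZ]
    exact S.add_mem (S.add_mem (S.add_mem (S.smul_mem c s₂) S.zero_mem) (n_y g₂))
      (S.smul_mem _ (m_y g₃))
  · have h := (h 1).2.2
    simp only [one_mul] at h
    have hx : D (X * g₁) = (3 / 2 : ℝ) • A (Z ^ 2 * g₁) := by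
      have := hDX g₁
      linear_combination (norm := module) (2⁻¹ : ℝ) • this
    rw [h, hDY, hDZ, hx]
    exact S.add_mem (S.add_mem (S.add_mem (S.smul_mem c s₃) (S.smul_mem _ (m_zz g₁))) S.zero_mem)
      (m_x g₃)

variable {n : ℕ} (hn : 2 ≤ n)

theorem eventually_of_forall_mem {f : smoothFun (Fin (2 * n) → ℝ)}
    (hf : ∀ x ∈ W8 hn, f.1 x = 0) : ∀ᶠ x in 𝓝 (0 : Fin (2 * n) → ℝ), x ∈ W8 hn → f.1 x = 0 :=
  Eventually.of_forall hf

/-- The coordinate `x_{k+1}`, `k = 0, 1, 2`, as a smooth function. -/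
def cx (k : Fin 3) : smoothFun (Fin (2 * n) → ℝ) := coord (ix hn k)

/-- The relations `[g df ∧ ξ] = 0` for `f = x_1² + x_3³`. -/
theorem relation_first (ξ : (Fin (2 * n) → ℝ) →L[ℝ] ℝ) (g : smoothFun (Fin (2 * n) → ℝ)) :
    (2 : ℝ) • wedgeRestr (W8 hn) (dx hn 0) ξ (cx hn 0 * g) +
      (3 : ℝ) • wedgeRestr (W8 hn) (dx hn 2) ξ (cx hn 2 ^ 2 * g) = 0 := by
  have h := sum_wedgeRestr_eq_zero Finset.univ
    (f := cx hn 0 * cx hn 0 + cx hn 2 * (cx hn 2 * cx hn 2))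
    (eventually_of_forall_mem hn fun x hx => by
      change x (ix hn 0) * x (ix hn 0) + x (ix hn 2) * (x (ix hn 2) * x (ix hn 2)) = 0
      linear_combination hx.1)
    (a := ![dx hn 0, dx hn 2]) (q := ![(2 : ℝ) • cx hn 0, (3 : ℝ) • (cx hn 2) ^ 2]) (fun x => by
      ext v
      rw [← pd_apply]
      simp only [map_add, pd_mul, cx, pd_coord]
      simp [Fin.sum_univ_two, coord, dx]
      ring) ξ g
  simpa [Fin.sum_univ_two] using h

/-- The relations `[g df ∧ ξ] = 0` for `f = x_2² + x_1 x_3`. -/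
theorem relation_second (ξ : (Fin (2 * n) → ℝ) →L[ℝ] ℝ) (g : smoothFun (Fin (2 * n) → ℝ)) :
    wedgeRestr (W8 hn) (dx hn 0) ξ (cx hn 2 * g) +
      (2 : ℝ) • wedgeRestr (W8 hn) (dx hn 1) ξ (cx hn 1 * g) +
      wedgeRestr (W8 hn) (dx hn 2) ξ (cx hn 0 * g) = 0 := by
  have h := sum_wedgeRestr_eq_zero Finset.univ
    (f := cx hn 1 * cx hn 1 + cx hn 0 * cx hn 2)
    (eventually_of_forall_mem hn fun x hx => by
      change x (ix hn 1) * x (ix hn 1) + x (ix hn 0) * x (ix hn 2) = 0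
      linear_combination hx.2.1)
    (a := ![dx hn 0, dx hn 1, dx hn 2]) (q := ![cx hn 2, (2 : ℝ) • cx hn 1, cx hn 0]) (fun x => by
      ext v
      rw [← pd_apply]
      simp only [map_add, pd_mul, cx, pd_coord]
      simp [Fin.sum_univ_three, coord, dx]
      ring) ξ g
  simpa [Fin.sum_univ_three] using h

/-- The relations `[g dx_j ∧ ξ] = 0` for `j ≥ 4`. -/
theorem relation_coord {j : Fin (2 * n)} (hj : 3 ≤ (j : ℕ)) (ξ : (Fin (2 * n) → ℝ) →L[ℝ] ℝ)
    (g : smoothFun (Fin (2 * n) → ℝ)) :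
    wedgeRestr (W8 hn) (ContinuousLinearMap.proj j) ξ g = 0 := by
  have h := sum_wedgeRestr_eq_zero Finset.univ (f := coord j)
    (eventually_of_forall_mem hn fun x hx => hx.2.2 j hj)
    (a := fun _ : Fin 1 => ContinuousLinearMap.proj j) (q := fun _ => 1) (fun x => by
      ext v
      rw [← pd_apply, pd_coord]
      simp) ξ g
  simpa using h

theorem exists_ix_eq {j : Fin (2 * n)} (hj : ¬ 3 ≤ (j : ℕ)) : ∃ k, ix hn k = j :=
  ⟨⟨j, by omega⟩, rfl⟩

/-- On `W_8`, only the first three coordinates contribute to Hadamard's formula. -/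
theorem exists_hadamard_W8 (g : smoothFun (Fin (2 * n) → ℝ)) :
    ∃ (c : ℝ) (g₁ g₂ g₃ : smoothFun (Fin (2 * n) → ℝ)), ∀ a b h,
      wedgeRestr (W8 hn) a b (h * g) = c • wedgeRestr (W8 hn) a b h +
        wedgeRestr (W8 hn) a b (h * cx hn 0 * g₁) + wedgeRestr (W8 hn) a b (h * cx hn 1 * g₂) +
        wedgeRestr (W8 hn) a b (h * cx hn 2 * g₃) := by
  obtain ⟨q, hq⟩ := exists_hadamard g
  refine ⟨g.1 0, q (ix hn 0), q (ix hn 1), q (ix hn 2), fun a b h => ?_⟩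
  conv_lhs => rw [hq]
  have hsum : ∑ j, wedgeRestr (W8 hn) a b (h * (coord j * q j)) =
      ∑ k : Fin 3, wedgeRestr (W8 hn) a b (h * (coord (ix hn k) * q (ix hn k))) := by
    refine (Fintype.sum_of_injective (ix hn) (ix_injective hn) _ _ (fun j hj => ?_)
      fun _ => rfl).symm
    refine wedgeRestr_eq_zero (eventually_of_forall_mem hn fun x hx => ?_) a b
    have h3 : 3 ≤ (j : ℕ) := by
      by_contra h3
      exact hj (exists_ix_eq hn h3)
    change h.1 x * (x j * (q j).1 x) = 0
    rw [hx.2.2 j h3]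
    ring
  rw [mul_add, map_add, Finset.mul_sum, map_sum, hsum, Fin.sum_univ_three, mul_smul_comm,
    map_smul, mul_one]
  simp only [cx, mul_assoc, add_assoc]

/-- The algebraic restriction to `W_8` of every form `f dx_i ∧ dx_j` lies in any subspace that
contains nine particular ones. -/
theorem wedgeRestr_mem (S : Submodule ℝ (AlgRestr (W8 hn)))
    (s₁ : wedgeRestr (W8 hn) (dx hn 1) (dx hn 2) 1 ∈ S)
    (s₂ : wedgeRestr (W8 hn) (dx hn 0) (dx hn 2) 1 ∈ S)
    (s₃ : wedgeRestr (W8 hn) (dx hn 0) (dx hn 1) 1 ∈ S)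
    (s₄ : wedgeRestr (W8 hn) (dx hn 1) (dx hn 2) (cx hn 2) ∈ S)
    (s₅ : wedgeRestr (W8 hn) (dx hn 1) (dx hn 2) (cx hn 1) ∈ S)
    (s₆ : wedgeRestr (W8 hn) (dx hn 1) (dx hn 2) (cx hn 0) ∈ S)
    (s₆' : wedgeRestr (W8 hn) (dx hn 0) (dx hn 2) (cx hn 1) ∈ S)
    (s₇ : wedgeRestr (W8 hn) (dx hn 1) (dx hn 2) (cx hn 2 ^ 2) ∈ S)
    (s₈ : wedgeRestr (W8 hn) (dx hn 1) (dx hn 2) (cx hn 1 ^ 2) ∈ S)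
    (i j : Fin (2 * n)) (g : smoothFun (Fin (2 * n) → ℝ)) :
    wedgeRestr (W8 hn) (ContinuousLinearMap.proj i) (ContinuousLinearMap.proj j) g ∈ S := by
  set W := wedgeRestr (W8 hn) with hW
  have hBX : ∀ g, W (dx hn 0) (dx hn 2) (cx hn 0 * g) = 0 := fun g => by
    have h := relation_first hn (dx hn 2) g
    rw [wedgeRestr_self, smul_zero, add_zero] at h
    exact (smul_eq_zero.1 h).resolve_left two_ne_zero
  obtain ⟨hA, hB, hD⟩ := mem_of_relations (W (dx hn 1) (dx hn 2)) (W (dx hn 0) (dx hn 2))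
    (W (dx hn 0) (dx hn 1)) (cx hn 0) (cx hn 1) (cx hn 2) S (fun g => by
      obtain ⟨c, g₁, g₂, g₃, h⟩ := exists_hadamard_W8 hn g
      exact ⟨c, g₁, g₂, g₃, fun k => ⟨h _ _ k, h _ _ k, h _ _ k⟩⟩)
    (fun g => by
      have h := relation_first hn (dx hn 0) g
      rw [wedgeRestr_self, smul_zero, zero_add, wedgeRestr_swap, smul_neg, neg_eq_zero] at h
      exact (smul_eq_zero.1 h).resolve_left three_ne_zero)
    hBX
    (fun g => by
      have h := relation_first hn (dx hn 1) g
      rw [wedgeRestr_swap (dx hn 2)] at h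
      linear_combination (norm := module) h)
    (fun g => by
      have h := relation_second hn (dx hn 0) g
      rw [wedgeRestr_self, zero_add, wedgeRestr_swap (dx hn 1), wedgeRestr_swap (dx hn 2),
        ← hW, hBX, neg_zero, add_zero, smul_neg, neg_eq_zero] at h
      exact (smul_eq_zero.1 h).resolve_left two_ne_zero)
    (fun g => by
      have h := relation_second hn (dx hn 1) g
      rw [wedgeRestr_self, smul_zero, add_zero, wedgeRestr_swap (dx hn 2)] at h
      linear_combination (norm := module) h)
    (fun g => by
      have h := relation_second hn (dx hn 2) g
      rw [wedgeRestr_self, add_zero] at h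
      linear_combination (norm := module) h)
    (fun g => wedgeRestr_eq_zero (eventually_of_forall_mem hn fun x hx => by
      change (x (ix hn 0) ^ 2 + x (ix hn 2) ^ 3) * g.1 x = 0
      rw [hx.1, zero_mul]) _ _)
    (fun g => wedgeRestr_eq_zero (eventually_of_forall_mem hn fun x hx => by
      change (x (ix hn 1) ^ 2 + x (ix hn 0) * x (ix hn 2)) * g.1 x = 0
      rw [hx.2.1, zero_mul]) _ _)
    (fun g => wedgeRestr_eq_zero (eventually_of_forall_mem hn fun x hx => by
      change (x (ix hn 1) ^ 2 + x (ix hn 0) * x (ix hn 2)) * g.1 x = 0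
      rw [hx.2.1, zero_mul]) _ _)
    s₁ s₂ s₃ s₄ s₅ s₆ s₆' s₇ s₈
  by_cases hi : 3 ≤ (i : ℕ)
  · rw [hW, relation_coord hn hi]
    exact S.zero_mem
  by_cases hj : 3 ≤ (j : ℕ)
  · rw [hW, wedgeRestr_swap, relation_coord hn hj, neg_zero]
    exact S.zero_mem
  obtain ⟨k, rfl⟩ := exists_ix_eq hn hi
  obtain ⟨l, rfl⟩ := exists_ix_eq hn hj
  change W (dx hn k) (dx hn l) g ∈ S
  have hswap : ∀ k l, W (dx hn k) (dx hn l) g ∈ S → W (dx hn l) (dx hn k) g ∈ S :=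
    fun k l h => by
      rw [hW, wedgeRestr_swap]
      exact S.neg_mem h
  have hself : ∀ k, W (dx hn k) (dx hn k) g ∈ S := fun k => by
    rw [hW, wedgeRestr_self]
    exact S.zero_mem
  fin_cases k <;> fin_cases l
  exacts [hself 0, hD g, hB g, hswap 0 1 (hD g), hself 1, hA g, hswap 0 2 (hB g),
    hswap 1 2 (hA g), hself 2]

end Generation

/-! ### Linear independence of `θ_1, …, θ_8` -/

section Independence

/-- Evaluation at `0`. -/
def evalZero {E : Type*} [NormedAddCommGroup E] [NormedSpace ℝ E] : smoothFun E →ₗ[ℝ] ℝ where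
  toFun f := f.1 0
  map_add' _ _ := rfl
  map_smul' _ _ := rfl

variable {n : ℕ} (hn : 2 ≤ n)

/-- Linear conditions on the Taylor coefficients at `0` of a 2-form
`a dx_2 ∧ dx_3 + b dx_1 ∧ dx_3 + c dx_1 ∧ dx_2 + ⋯` with zero algebraic restriction to `W_8`: one
for each of the degrees `9, 10, 11, 13, 14, 17, 19`, and two for the degree `15`. -/
theorem jet_of_mem_zeroAlgRestr
    {σ : (Fin (2 * n) → ℝ) → (Fin (2 * n) → ℝ) [⋀^Fin 2]→L[ℝ] ℝ} {hσ : ContDiff ℝ ∞ σ}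
    (h : ofSmooth σ hσ ∈ zeroAlgRestr (W8 hn)) :
    let P := fun k => pd (ex hn k)
    let a := component σ hσ ![ex hn 1, ex hn 2]
    let b := component σ hσ ![ex hn 0, ex hn 2]
    let c := component σ hσ ![ex hn 0, ex hn 1]
    (evalZero a = 0 ∧ evalZero b = 0 ∧ evalZero c = 0) ∧
    evalZero (P 2 a) = 0 ∧
    evalZero (P 1 a) - 2 * evalZero (P 2 b) = 0 ∧
    (evalZero (P 1 b) = 0 ∧ evalZero (P 0 a) + evalZero (P 2 c) = 0) ∧
    evalZero (P 2 (P 2 a)) + 3 * evalZero (P 0 c) = 0 ∧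
    evalZero (P 1 (P 1 a)) - 2 * evalZero (P 0 (P 2 a)) - 4 * evalZero (P 1 (P 2 b)) -
      evalZero (P 2 (P 2 c)) = 0 := by
  intro P a b c
  obtain ⟨α, β, hα, hβ, hab⟩ := exists_components_of_mem_zeroAlgRestr h
  have e0 : ∀ {f g : smoothFun (Fin (2 * n) → ℝ)}, f.1 =ᶠ[𝓝 0] g.1 → evalZero f = evalZero g :=
    fun h => h.eq_of_nhds
  have e1 : ∀ {f g : smoothFun (Fin (2 * n) → ℝ)}, f.1 =ᶠ[𝓝 0] g.1 → ∀ k,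
      (P k f).1 =ᶠ[𝓝 0] (P k g).1 := fun h k => pd_eventuallyEq h _
  have hev : ∀ g : smoothFun (Fin (2 * n) → ℝ), g.1 0 = evalZero g := fun _ => rfl
  have hP : ∀ k, pd (ex hn k) = P k := fun _ => rfl
  have hcomm : ∀ i j g, P i (P j g) = P j (P i g) := fun i j g => pd_comm _ _ g
  have ha : a.1 =ᶠ[𝓝 0] _ := hab (ex hn 1) (ex hn 2)
  have hb : b.1 =ᶠ[𝓝 0] _ := hab (ex hn 0) (ex hn 2)
  have hc : c.1 =ᶠ[𝓝 0] _ := hab (ex hn 0) (ex hn 1)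
  obtain ⟨⟨j0, j1, j2, j3⟩, ⟨j4, -, -, j7⟩, -, -, -, -⟩ :=
    jet_of_vanishing hn (hα (ex hn 1) (ex hn 2))
  simp only [hev, hP] at j0 j1 j2 j3 j4 j7
  obtain ⟨⟨k0, -, k2, k3⟩, ⟨-, k5, -, -⟩, -, -, -, -⟩ :=
    jet_of_vanishing hn (hα (ex hn 0) (ex hn 2))
  simp only [hev, hP] at k0 k2 k3 k5
  obtain ⟨⟨l0, l1, -, l3⟩, ⟨l4, -, -, -⟩, -, -, -, -⟩ :=
    jet_of_vanishing hn (hα (ex hn 0) (ex hn 1))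
  simp only [hev, hP] at l0 l1 l3 l4
  obtain ⟨⟨-, -, p2, p3⟩, ⟨p4, p5, p6, -⟩, -, p9, -, -⟩ :=
    jet_of_vanishing hn (hβ (ex hn 0))
  simp only [hev, hP] at p2 p3 p4 p5 p6 p9
  obtain ⟨⟨-, q1, -, q3⟩, ⟨q4, q5, -, -⟩, q8, -, q10, -⟩ :=
    jet_of_vanishing hn (hβ (ex hn 1))
  simp only [hev, hP] at q1 q3 q4 q5 q8 q10
  obtain ⟨⟨-, r1, r2, -⟩, ⟨-, r5, r6, r7⟩, -, r9, -, r11⟩ :=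
    jet_of_vanishing hn (hβ (ex hn 2))
  simp only [hev, hP] at r1 r2 r5 r6 r7 r9 r11
  simp only [hP] at ha hb hc
  clear_value P a b c
  have a_ := e0 ha
  have b_ := e0 hb
  have c_ := e0 hc
  have a0 := e0 (e1 ha 0)
  have a1 := e0 (e1 ha 1)
  have a2 := e0 (e1 ha 2)
  have b1 := e0 (e1 hb 1)
  have b2 := e0 (e1 hb 2)
  have c0 := e0 (e1 hc 0)
  have c2 := e0 (e1 hc 2)
  have a11 := e0 (e1 (e1 ha 1) 1)
  have a02 := e0 (e1 (e1 ha 2) 0)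
  have a22 := e0 (e1 (e1 ha 2) 2)
  have b12 := e0 (e1 (e1 hb 2) 1)
  have c22 := e0 (e1 (e1 hc 2) 2)
  simp only [map_add, map_sub, hcomm 1 0, hcomm 2 0, hcomm 2 1] at a_ b_ c_ a0 a1 a2 b1 b2 c0 c2
  simp only [map_add, map_sub, hcomm 1 0, hcomm 2 0, hcomm 2 1] at a11 a02 a22 b12 c22
  refine ⟨⟨?_, ?_, ?_⟩, ?_, ?_, ⟨?_, ?_⟩, ?_, ?_⟩
  · linear_combination a_ + j0 + r2 - q3
  · linear_combination b_ + k0 + r1 - p3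
  · linear_combination c_ + l0 + q1 - p2
  · linear_combination a2 + j3 + r5 - q4
  · linear_combination a1 - 2 * b2 + j2 - 2 * k3 + r7 - q5 + 2 * p4
  · linear_combination b1 + k2 + r6 - p5
  · linear_combination a0 + c2 + j1 + l3 + r6 - p5
  · linear_combination a22 + 3 * c0 + j4 + 3 * l1 + r9 + q8 - 3 * p6
  · linear_combination a11 - 2 * a02 - 4 * b12 - c22 + j7 - 4 * k5 - l4 + r11 + q10 + 5 * p9

theorem thetaGerm_eq (i : Fin 8) :
    thetaGerm hn i = ofSmooth (theta hn i) (contDiff_theta hn i) := rfl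

theorem contDiff_sum_theta (c : Fin 8 → ℝ) :
    ContDiff ℝ ∞ fun x => ∑ i, c i • theta hn i x :=
  ContDiff.sum fun i _ => (contDiff_theta hn i).const_smul (c i)

theorem sum_thetaGerm (c : Fin 8 → ℝ) :
    ∑ i, c i • thetaGerm hn i = ofSmooth _ (contDiff_sum_theta hn c) := by
  simp only [thetaGerm_eq, ofSmooth_smul]
  rw [ofSmooth_sum]

theorem sum_theta_apply (c : Fin 8 → ℝ) (x v w : Fin (2 * n) → ℝ) :
    (∑ i, c i • theta hn i x) ![v, w] =
      (c 0 + c 3 * x (ix hn 2) + c 4 * x (ix hn 1) + c 5 * x (ix hn 0) + c 6 * x (ix hn 2) ^ 2 +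
        c 7 * x (ix hn 1) ^ 2) * wedge (dx hn 1) (dx hn 2) ![v, w] +
      (c 1 + c 5 * x (ix hn 1)) * wedge (dx hn 0) (dx hn 2) ![v, w] +
      c 2 * wedge (dx hn 0) (dx hn 1) ![v, w] := by
  simp only [Fin.sum_univ_eight]
  simp [theta]
  ring

theorem dx_ex (k l : Fin 3) : dx hn k (ex hn l) = if k = l then 1 else 0 :=
  ex_apply_ix hn l k

/-- The functionals of `jet_of_mem_zeroAlgRestr` separate `θ_1, …, θ_8`. -/
theorem eq_zero_of_sum_mem_zeroAlgRestr {c : Fin 8 → ℝ}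
    (h : ∑ i, c i • thetaGerm hn i ∈ zeroAlgRestr (W8 hn)) : c = 0 := by
  rw [sum_thetaGerm] at h
  have key := jet_of_mem_zeroAlgRestr hn h
  have ha : component _ (contDiff_sum_theta hn c) ![ex hn 1, ex hn 2] = c 0 • 1 + c 3 • cx hn 2 +
      c 4 • cx hn 1 + c 5 • cx hn 0 + c 6 • (cx hn 2 * cx hn 2) + c 7 • (cx hn 1 * cx hn 1) := by
    ext x
    change (∑ i, c i • theta hn i x) ![ex hn 1, ex hn 2] = c 0 * 1 + c 3 * x (ix hn 2) +
      c 4 * x (ix hn 1) + c 5 * x (ix hn 0) + c 6 * (x (ix hn 2) * x (ix hn 2)) +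
      c 7 * (x (ix hn 1) * x (ix hn 1))
    rw [sum_theta_apply]
    simp [wedge_apply, dx_ex]
    ring
  have hb : component _ (contDiff_sum_theta hn c) ![ex hn 0, ex hn 2] =
      c 1 • 1 + c 5 • cx hn 1 := by
    ext x
    change (∑ i, c i • theta hn i x) ![ex hn 0, ex hn 2] = c 1 * 1 + c 5 * x (ix hn 1)
    rw [sum_theta_apply]
    simp [wedge_apply, dx_ex]
  have hc : component _ (contDiff_sum_theta hn c) ![ex hn 0, ex hn 1] = c 2 • 1 := by
    ext x
    change (∑ i, c i • theta hn i x) ![ex hn 0, ex hn 1] = c 2 * 1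
    rw [sum_theta_apply]
    simp [wedge_apply, dx_ex]
  have ev1 : evalZero (1 : smoothFun (Fin (2 * n) → ℝ)) = 1 := rfl
  have evx : ∀ k, evalZero (cx hn k) = 0 := fun _ => rfl
  have evm : ∀ f g : smoothFun (Fin (2 * n) → ℝ), evalZero (f * g) = evalZero f * evalZero g :=
    fun _ _ => rfl
  have pdx : ∀ k l, pd (ex hn k) (cx hn l) = (if l = k then (1 : ℝ) else 0) • 1 := fun k l => by
    rw [cx, pd_coord, ex_apply_ix]
  simp only [ha, hb, hc, map_add, map_smul, pd_mul, pdx, pd_one, ev1, evx, evm, smul_eq_mul,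
    map_zero, mul_zero, mul_one, add_zero, zero_add] at key
  simp at key
  obtain ⟨⟨h0, h1, h2⟩, h3, h4, h5, h7, h8⟩ := key
  ext i
  fin_cases i <;> simp <;> linarith

theorem linearIndependent_algRestr_theta :
    LinearIndependent ℝ fun i : Fin 8 => algRestr (W8 hn) (thetaGerm hn i) := by
  rw [Fintype.linearIndependent_iff]
  intro c hc
  simp only [← map_smul, ← map_sum] at hc
  rw [algRestr_eq_zero_iff] at hc
  exact congrFun (eq_zero_of_sum_mem_zeroAlgRestr hn hc)

end Independence

/-! ### Algebraic restrictions of closed forms -/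

section Closed

variable {n : ℕ} (hn : 2 ≤ n)

/-- Each `θ_i` is of the form `dφ ∧ dx_k = d(φ dx_k)`. -/
theorem exists_theta_eq_wedge (i : Fin 8) : ∃ (φ : smoothFun (Fin (2 * n) → ℝ)) (k : Fin 3),
    ∀ x, theta hn i x = wedge (fderiv ℝ φ.1 x) (dx hn k) := by
  -- the same identity on pairs of vectors
  have key : ∀ (φ : smoothFun (Fin (2 * n) → ℝ)) (k : Fin 3)
      (h : ∀ x v, theta hn i x v = (pd (v 0) φ).1 x * dx hn k (v 1) -
        (pd (v 1) φ).1 x * dx hn k (v 0)), ∃ (φ : smoothFun (Fin (2 * n) → ℝ)) (k : Fin 3),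
      ∀ x, theta hn i x = wedge (fderiv ℝ φ.1 x) (dx hn k) := fun φ k h => ⟨φ, k, fun x => by
    ext v
    rw [h, wedge_apply, pd_apply, pd_apply]⟩
  fin_cases i
  · refine key (cx hn 1) 2 fun x v => ?_
    simp [theta, wedge_apply, cx, pd_coord, dx]
  · refine key (cx hn 0) 2 fun x v => ?_
    simp [theta, wedge_apply, cx, pd_coord, dx]
  · refine key (cx hn 0) 1 fun x v => ?_
    simp [theta, wedge_apply, cx, pd_coord, dx]
  · refine key ((-1 / 2 : ℝ) • (cx hn 2 * cx hn 2)) 1 fun x v => ?_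
    simp [theta, wedge_apply, cx, pd_coord, dx, pd_mul, coord_apply]
    ring
  · refine key ((1 / 2 : ℝ) • (cx hn 1 * cx hn 1)) 2 fun x v => ?_
    simp [theta, wedge_apply, cx, pd_coord, dx, pd_mul, coord_apply]
    ring
  · refine key (cx hn 0 * cx hn 1) 2 fun x v => ?_
    simp [theta, wedge_apply, cx, pd_coord, dx, pd_mul, coord_apply]
    ring
  · refine key ((-1 / 3 : ℝ) • (cx hn 2 * (cx hn 2 * cx hn 2))) 1 fun x v => ?_
    simp [theta, wedge_apply, cx, pd_coord, dx, pd_mul, coord_apply]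
    ring
  · refine key ((1 / 3 : ℝ) • (cx hn 1 * (cx hn 1 * cx hn 1))) 2 fun x v => ?_
    simp [theta, wedge_apply, cx, pd_coord, dx, pd_mul, coord_apply]
    ring

theorem d_thetaGerm (i : Fin 8) : d 2 (thetaGerm hn i) = 0 := by
  obtain ⟨φ, k, h⟩ := exists_theta_eq_wedge hn i
  have : thetaGerm hn i = d 1 (ofSmooth _ (contDiff_smulOneForm (contDiff_coe φ) (dx hn k))) := by
    rw [thetaGerm_eq, d_ofSmooth, ofSmooth_eq_iff]
    refine Eventually.of_forall fun x => ?_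
    rw [extDeriv_smulOneForm ((contDiff_coe φ).differentiable (by simp) x), h]
  rw [this, d_d]

theorem d_sum_thetaGerm (c : Fin 8 → ℝ) : d 2 (∑ i, c i • thetaGerm hn i) = 0 := by
  simp [map_sum, d_thetaGerm]

theorem algRestr_sum_thetaGerm (c : Fin 8 → ℝ) :
    algRestr (W8 hn) (∑ i, c i • thetaGerm hn i) =
      ∑ i, c i • algRestr (W8 hn) (thetaGerm hn i) := by
  simp

/-- The algebraic restriction of every 2-form is a combination of those of `θ_1, …, θ_8` and of
`x_1 dx_2 ∧ dx_3`. -/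
theorem exists_algRestr_eq_add (g : FormGerm (Fin (2 * n) → ℝ) 2) :
    ∃ (c : Fin 8 → ℝ) (e : ℝ), algRestr (W8 hn) g =
      algRestr (W8 hn) (∑ i, c i • thetaGerm hn i) +
        e • wedgeRestr (W8 hn) (dx hn 1) (dx hn 2) (cx hn 0) := by
  set S := Submodule.span ℝ (Set.range fun i : Fin 8 => algRestr (W8 hn) (thetaGerm hn i)) ⊔
    Submodule.span ℝ {wedgeRestr (W8 hn) (dx hn 1) (dx hn 2) (cx hn 0)} with hS
  have hθ : ∀ i, algRestr (W8 hn) (thetaGerm hn i) ∈ S := fun i =>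
    Submodule.mem_sup_left (Submodule.subset_span ⟨i, rfl⟩)
  have hx : wedgeRestr (W8 hn) (dx hn 1) (dx hn 2) (cx hn 0) ∈ S :=
    Submodule.mem_sup_right (Submodule.mem_span_singleton_self _)
  have hw : ∀ i k l (f : smoothFun (Fin (2 * n) → ℝ)),
      (∀ x, theta hn i x = f.1 x • wedge (dx hn k) (dx hn l)) →
        wedgeRestr (W8 hn) (dx hn k) (dx hn l) f ∈ S := fun i k l f h => by
    convert hθ i using 1
    rw [wedgeRestr_apply, thetaGerm_eq]
    congr 1
    rw [ofSmooth_eq_iff]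
    exact Eventually.of_forall fun x => (h x).symm
  -- `x_2 dx_1 ∧ dx_3 = θ_6 - x_1 dx_2 ∧ dx_3`
  have hx' : wedgeRestr (W8 hn) (dx hn 0) (dx hn 2) (cx hn 1) ∈ S := by
    have h : algRestr (W8 hn) (thetaGerm hn 5) = wedgeRestr (W8 hn) (dx hn 1) (dx hn 2) (cx hn 0) +
        wedgeRestr (W8 hn) (dx hn 0) (dx hn 2) (cx hn 1) := by
      rw [wedgeRestr_apply, wedgeRestr_apply, ← map_add, ofSmooth_add]
      rfl
    have h' := S.sub_mem (hθ 5) hx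
    rwa [h, add_sub_cancel_left] at h'
  have hmem := wedgeRestr_mem hn S (hw 0 1 2 1 fun x => (one_smul ℝ _).symm)
    (hw 1 0 2 1 fun x => (one_smul ℝ _).symm) (hw 2 0 1 1 fun x => (one_smul ℝ _).symm)
    (hw 3 1 2 _ fun x => rfl) (hw 4 1 2 _ fun x => rfl) hx hx' (hw 6 1 2 _ fun x => rfl)
    (hw 7 1 2 _ fun x => rfl)
  have hg : algRestr (W8 hn) g ∈ S := by
    obtain ⟨σ, hσ, rfl⟩ := exists_eq_ofSmooth g
    have h : ofSmooth σ hσ = ∑ i, ∑ j, ofSmooth _ (contDiff_smul_wedge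
        ((2⁻¹ : ℝ) • component σ hσ ![Pi.single i 1, Pi.single j 1])
          (ContinuousLinearMap.proj i) (ContinuousLinearMap.proj j)) := by
      simp only [ofSmooth_sum]
      rw [ofSmooth_eq_iff]
      exact Eventually.of_forall fun x => eq_sum_smul_wedge (σ x)
    rw [h]
    simp only [map_sum]
    exact S.sum_mem fun i _ => S.sum_mem fun j _ => hmem i j _
  obtain ⟨s, hs, t, ht, hst⟩ := Submodule.mem_sup.1 hg
  obtain ⟨c, rfl⟩ := (Submodule.mem_span_range_iff_exists_fun ℝ).1 hs
  obtain ⟨e, rfl⟩ := Submodule.mem_span_singleton.1 ht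
  exact ⟨c, e, by rw [← hst, algRestr_sum_thetaGerm]⟩

/-- The component of `dσ` along `dx_1 ∧ dx_2 ∧ dx_3` vanishes at `0` if the 2-form `σ` has zero
algebraic restriction to `W_8`. -/
theorem extDeriv_apply_eq_zero_of_mem_zeroAlgRestr
    {σ : (Fin (2 * n) → ℝ) → (Fin (2 * n) → ℝ) [⋀^Fin 2]→L[ℝ] ℝ} {hσ : ContDiff ℝ ∞ σ}
    (h : ofSmooth σ hσ ∈ zeroAlgRestr (W8 hn)) :
    extDeriv σ 0 ![ex hn 0, ex hn 1, ex hn 2] = 0 := by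
  obtain ⟨-, -, -, ⟨h1, h2⟩, -⟩ := jet_of_mem_zeroAlgRestr hn h
  rw [extDeriv_apply_three (hσ.differentiable (by simp) 0)]
  change evalZero (pd (ex hn 0) (component σ hσ ![ex hn 1, ex hn 2])) -
    evalZero (pd (ex hn 1) (component σ hσ ![ex hn 0, ex hn 2])) +
    evalZero (pd (ex hn 2) (component σ hσ ![ex hn 0, ex hn 1])) = 0
  linarith

/-- The algebraic restrictions of `θ_1, …, θ_8` span those of the closed 2-forms. -/
theorem exists_algRestr_eq_of_closed {g : FormGerm (Fin (2 * n) → ℝ) 2} (hg : d 2 g = 0) :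
    ∃ c : Fin 8 → ℝ, algRestr (W8 hn) g = algRestr (W8 hn) (∑ i, c i • thetaGerm hn i) := by
  obtain ⟨c, e, h⟩ := exists_algRestr_eq_add hn g
  refine ⟨c, ?_⟩
  -- `d (x_1 dx_2 ∧ dx_3) = dx_1 ∧ dx_2 ∧ dx_3` does not vanish at `0`
  suffices he : e = 0 by rw [h, he, zero_smul, add_zero]
  have hz : g - ∑ i, c i • thetaGerm hn i -
      e • ofSmooth _ (contDiff_smul_wedge (cx hn 0) (dx hn 1) (dx hn 2)) ∈
        zeroAlgRestr (W8 hn) := by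
    rw [← algRestr_eq_zero_iff, map_sub, map_sub, map_smul, ← wedgeRestr_apply, h]
    abel
  obtain ⟨σ, hσ, hz'⟩ := exists_eq_ofSmooth (g - ∑ i, c i • thetaGerm hn i -
      e • ofSmooth _ (contDiff_smul_wedge (cx hn 0) (dx hn 1) (dx hn 2)))
  rw [hz'] at hz
  have hd := congrArg (d 2) hz'
  have hτ := contDiff_smul_wedge (cx hn 0) (dx hn 1) (dx hn 2)
  rw [map_sub, map_sub, hg, d_sum_thetaGerm, sub_zero, zero_sub, ← map_neg, ← neg_one_smul ℝ,
    smul_smul, map_smul, d_ofSmooth, d_ofSmooth, ofSmooth_smul, ofSmooth_eq_iff] at hd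
  have h0 := hd.eq_of_nhds
  have h1 := extDeriv_apply_eq_zero_of_mem_zeroAlgRestr hn hz
  rw [← h0, ContinuousAlternatingMap.smul_apply,
    extDeriv_apply_three (hτ.differentiable (by simp) 0)] at h1
  have h2 : ∀ v w : Fin (2 * n) → ℝ,
      (fun y => ((cx hn 0).1 y • wedge (dx hn 1) (dx hn 2)) ![v, w]) =
      (wedge (dx hn 1) (dx hn 2) ![v, w] • cx hn 0).1 := fun v w => by
    ext y
    exact mul_comm _ _
  simp only [h2] at h1
  simp only [← pd_apply, map_smul, cx, pd_coord] at h1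
  simpa [wedge_apply, dx_ex, ex_apply_ix] using h1

theorem span_algRestr_theta :
    Submodule.span ℝ (Set.range fun i : Fin 8 => algRestr (W8 hn) (thetaGerm hn i)) =
      closedRestr (W8 hn) := by
  apply le_antisymm
  · rw [Submodule.span_le]
    rintro _ ⟨i, rfl⟩
    exact Submodule.mem_map_of_mem (d_thetaGerm hn i)
  · rintro _ ⟨g, hg, rfl⟩
    obtain ⟨c, hc⟩ := exists_algRestr_eq_of_closed hn hg
    rw [hc, algRestr_sum_thetaGerm]
    exact (Submodule.mem_span_range_iff_exists_fun ℝ).2 ⟨c, rfl⟩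

end Closed

/-! ### Quasi-homogeneity -/

section QuasiHomogeneous

variable {n : ℕ} (hn : 2 ≤ n)

theorem isQuasiHomogeneous_theta {w : Fin (2 * n) → ℝ} (h0 : w (ix hn 0) = 6)
    (h1 : w (ix hn 1) = 5) (h2 : w (ix hn 2) = 4) (i : Fin 8) :
    IsQuasiHomogeneous w (degree i) (theta hn i) := by
  intro t ht x
  have hpow : ∀ k : ℕ, t ^ (k : ℝ) = t ^ k := fun k => Real.rpow_natCast t k
  have p4 : t ^ (4 : ℝ) = t ^ 4 := by exact_mod_cast hpow 4
  have p5 : t ^ (5 : ℝ) = t ^ 5 := by exact_mod_cast hpow 5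
  have p6 : t ^ (6 : ℝ) = t ^ 6 := by exact_mod_cast hpow 6
  have p9 : t ^ (9 : ℝ) = t ^ 9 := by exact_mod_cast hpow 9
  have p10 : t ^ (10 : ℝ) = t ^ 10 := by exact_mod_cast hpow 10
  have p11 : t ^ (11 : ℝ) = t ^ 11 := by exact_mod_cast hpow 11
  have p13 : t ^ (13 : ℝ) = t ^ 13 := by exact_mod_cast hpow 13
  have p14 : t ^ (14 : ℝ) = t ^ 14 := by exact_mod_cast hpow 14
  have p15 : t ^ (15 : ℝ) = t ^ 15 := by exact_mod_cast hpow 15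
  have p17 : t ^ (17 : ℝ) = t ^ 17 := by exact_mod_cast hpow 17
  have p19 : t ^ (19 : ℝ) = t ^ 19 := by exact_mod_cast hpow 19
  have hd0 : ∀ y, dilation w t y (ix hn 0) = t ^ 6 * y (ix hn 0) := fun y => by
    simp [dilation, h0, p6]
  have hd1 : ∀ y, dilation w t y (ix hn 1) = t ^ 5 * y (ix hn 1) := fun y => by
    simp [dilation, h1, p5]
  have hd2 : ∀ y, dilation w t y (ix hn 2) = t ^ 4 * y (ix hn 2) := fun y => by
    simp [dilation, h2, p4]
  ext v
  fin_cases i <;>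
    simp [theta, degree, wedge_apply, dx, hd0, hd1, hd2, p9, p10, p11, p13, p14, p15, p17, p19] <;>
    ring

end QuasiHomogeneous

/-! ### Symplectic forms -/

section Symplectic

/-- Nondegeneracy of an alternating bilinear form on `ℝ^m`, as in `IsSymplectic`. -/
def Nondeg {m : ℕ} (η : (Fin m → ℝ) [⋀^Fin 2]→L[ℝ] ℝ) : Prop :=
  ∀ v : Fin m → ℝ, (∀ w : Fin m → ℝ, η ![v, w] = 0) → v = 0

theorem apply_add_left {E : Type*} [NormedAddCommGroup E] [NormedSpace ℝ E]
    (η : E [⋀^Fin 2]→L[ℝ] ℝ) (u v w : E) : η ![u + v, w] = η ![u, w] + η ![v, w] := by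
  exact η.toMultilinearMap.cons_add ![w] u v

theorem apply_smul_left {E : Type*} [NormedAddCommGroup E] [NormedSpace ℝ E]
    (η : E [⋀^Fin 2]→L[ℝ] ℝ) (c : ℝ) (v w : E) : η ![c • v, w] = c * η ![v, w] := by
  exact η.toMultilinearMap.cons_smul ![w] c v

theorem apply_eq_sum {m : ℕ} (η : (Fin m → ℝ) [⋀^Fin 2]→L[ℝ] ℝ) (v w : Fin m → ℝ) :
    η ![v, w] = ∑ i, v i * η ![Pi.single i 1, w] := by
  let L : (Fin m → ℝ) →ₗ[ℝ] ℝ :=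
    { toFun := fun v => η ![v, w]
      map_add' := fun u v => apply_add_left η u v w
      map_smul' := fun c v => apply_smul_left η c v w }
  change L v = ∑ i, v i * L (Pi.single i 1)
  conv_lhs => rw [pi_eq_sum_univ' v, map_sum]
  simp only [map_smul, smul_eq_mul]

/-- The Gram matrix of a 2-form in the standard basis. -/
def gram {m : ℕ} (η : (Fin m → ℝ) [⋀^Fin 2]→L[ℝ] ℝ) : Matrix (Fin m) (Fin m) ℝ :=
  Matrix.of fun i j => η ![Pi.single i 1, Pi.single j 1]

theorem vecMul_gram {m : ℕ} (η : (Fin m → ℝ) [⋀^Fin 2]→L[ℝ] ℝ) (v : Fin m → ℝ) (j : Fin m) :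
    Matrix.vecMul v (gram η) j = η ![v, Pi.single j 1] := by
  rw [apply_eq_sum η v]
  rfl

theorem nondeg_iff_det_gram_ne_zero {m : ℕ} (η : (Fin m → ℝ) [⋀^Fin 2]→L[ℝ] ℝ) :
    Nondeg η ↔ (gram η).det ≠ 0 := by
  rw [Ne, ← Matrix.exists_vecMul_eq_zero_iff]
  constructor
  · rintro h ⟨v, hv, hv0⟩
    refine hv (h v fun w => ?_)
    rw [apply_swap, apply_eq_sum η w, neg_eq_zero]
    refine Finset.sum_eq_zero fun j _ => ?_
    rw [apply_swap, ← vecMul_gram, hv0, Pi.zero_apply, neg_zero, mul_zero]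
  · intro h v hv
    by_contra hv0
    refine h ⟨v, hv0, ?_⟩
    ext j
    rw [vecMul_gram]
    exact hv _

theorem eventually_nondeg {m : ℕ} {σ : (Fin m → ℝ) → (Fin m → ℝ) [⋀^Fin 2]→L[ℝ] ℝ}
    (hσ : Continuous σ) (h : Nondeg (σ 0)) : ∀ᶠ x in 𝓝 0, Nondeg (σ x) := by
  simp only [nondeg_iff_det_gram_ne_zero] at h ⊢
  have hc : Continuous fun x => (gram (σ x)).det := by
    refine Continuous.matrix_det (continuous_matrix fun i j => ?_)
    exact (ContinuousAlternatingMap.apply ℝ (Fin m → ℝ) ℝ _).continuous.comp hσ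
  exact hc.continuousAt.eventually_ne h

variable {n : ℕ} (hn : 2 ≤ n)

/-- The value of `c_1 θ_1 + ⋯ + c_8 θ_8` at `0`. -/
theorem sum_theta_zero_apply (c : Fin 8 → ℝ) (v w : Fin (2 * n) → ℝ) :
    (∑ i, c i • theta hn i 0) ![v, w] =
      c 0 * (v (ix hn 1) * w (ix hn 2) - w (ix hn 1) * v (ix hn 2)) +
      c 1 * (v (ix hn 0) * w (ix hn 2) - w (ix hn 0) * v (ix hn 2)) +
      c 2 * (v (ix hn 0) * w (ix hn 1) - w (ix hn 0) * v (ix hn 1)) := by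
  rw [sum_theta_apply]
  simp [wedge_apply, dx]

/-- Adding to `c_1 θ_1 + ⋯ + c_8 θ_8` a constant form with zero algebraic restriction, so that the
sum is nondegenerate at `0`, gives a symplectic form with the same algebraic restriction. -/
theorem mem_sympRestr_of_nondeg {c : Fin 8 → ℝ} {κ : (Fin (2 * n) → ℝ) [⋀^Fin 2]→L[ℝ] ℝ}
    (hκ : algRestr (W8 hn) (ofSmooth (fun _ => κ) contDiff_const) = 0)
    (h : Nondeg (∑ i, c i • theta hn i 0 + κ)) :
    algRestr (W8 hn) (∑ i, c i • thetaGerm hn i) ∈ sympRestr (W8 hn) := by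
  refine ⟨∑ i, c i • thetaGerm hn i + ofSmooth (fun _ => κ) contDiff_const, ⟨?_, ?_⟩, ?_⟩
  · rw [map_add, d_sum_thetaGerm, zero_add, d_ofSmooth]
    refine Subtype.ext (Germ.coe_eq.2 (Eventually.of_forall fun x => ?_))
    simpa [extDeriv] using
      (ContinuousAlternatingMap.alternatizeUncurryFinCLM ℝ (Fin (2 * n) → ℝ) ℝ (n := 2)).map_zero
  · rw [sum_thetaGerm, ofSmooth_add]
    exact eventually_nondeg ((contDiff_sum_theta hn c).add contDiff_const).continuous h
  · rw [map_add, hκ, add_zero]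

theorem sympRestr_subset : sympRestr (W8 hn) ⊆ closedRestr (W8 hn) := by
  rintro _ ⟨g, hg, rfl⟩
  exact Submodule.mem_map_of_mem hg.1

theorem algRestr_const_wedge (a b : (Fin (2 * n) → ℝ) →L[ℝ] ℝ) :
    algRestr (W8 hn) (ofSmooth (fun _ => wedge a b) contDiff_const) =
      wedgeRestr (W8 hn) a b 1 := by
  rw [wedgeRestr_apply]
  congr 1
  rw [ofSmooth_eq_iff]
  exact Eventually.of_forall fun x => (one_smul ℝ _).symm

theorem sympRestr_eq_closedRestr (h3 : 3 ≤ n) :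
    sympRestr (W8 hn) = (closedRestr (W8 hn) : Set (AlgRestr (W8 hn))) := by
  refine (sympRestr_subset hn).antisymm ?_
  rintro _ ⟨g, hg, rfl⟩
  obtain ⟨c, hc⟩ := exists_algRestr_eq_of_closed hn hg
  rw [hc]
  -- the constant form `∑ dx_j ∧ dx_{2n+1-j}`, `j = 1, …, n`, in which each of the first three
  -- coordinates is paired with one of the others
  let ε : Fin (2 * n) → ℝ := fun j => if (j : ℕ) < n then 1 else 0
  let τ : Fin (2 * n) → (Fin (2 * n) → ℝ) [⋀^Fin 2]→L[ℝ] ℝ := fun j =>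
    ε j • wedge (ContinuousLinearMap.proj j) (ContinuousLinearMap.proj j.rev)
  have hτ : ∀ v m, (∑ j, τ j) ![v, Pi.single m 1] = (ε m.rev - ε m) * v m.rev := fun v m => by
    have : ∀ j, τ j ![v, Pi.single m 1] =
        (if j = m.rev then ε j * v j else 0) - if j = m then ε j * v j.rev else 0 := fun j => by
      have hr : j.rev = m ↔ j = m.rev := by rw [← Fin.rev_inj, Fin.rev_rev]
      simp only [τ, ContinuousAlternatingMap.smul_apply, wedge_apply, smul_eq_mul]
      simp [Pi.single_apply, hr, mul_sub]
    rw [ContinuousAlternatingMap.sum_apply]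
    simp only [this, Finset.sum_sub_distrib, Finset.sum_ite_eq', Finset.mem_univ, if_true]
    ring
  refine mem_sympRestr_of_nondeg hn (κ := ∑ j, τ j) ?_ fun v hv => ?_
  · have hsum : ofSmooth (fun _ : Fin (2 * n) → ℝ => ∑ j, τ j) contDiff_const =
        ∑ j, ε j • ofSmooth (fun _ : Fin (2 * n) → ℝ => wedge (ContinuousLinearMap.proj j)
          (ContinuousLinearMap.proj j.rev)) contDiff_const := by
      simp only [ofSmooth_smul]
      rw [ofSmooth_sum]
    rw [hsum, map_sum]
    refine Finset.sum_eq_zero fun j _ => ?_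
    rw [map_smul, algRestr_const_wedge]
    by_cases hj : (j : ℕ) < n
    · rw [wedgeRestr_swap, relation_coord hn (by rw [Fin.val_rev]; omega), neg_zero, smul_zero]
    · simp [ε, hj]
  · have hne : ∀ m : Fin (2 * n), ε m.rev - ε m ≠ 0 := fun m => by
      simp only [ε, Fin.val_rev]
      split_ifs <;> first | omega | norm_num
    simp only [ContinuousAlternatingMap.add_apply, sum_theta_zero_apply] at hv
    have hval : ∀ k : Fin 3, ((ix hn k : Fin (2 * n)) : ℕ) = k := fun k => rfl
    -- pairing with the last three basis vectors kills the first three coordinates of `v`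
    have hfirst : ∀ k : Fin 3, v (ix hn k) = 0 := fun k => by
      have h := hv (Pi.single (ix hn k).rev 1)
      have h0 : ∀ l : Fin 3, (Pi.single (ix hn k).rev 1 : Fin (2 * n) → ℝ) (ix hn l) = 0 :=
        fun l => by
          rw [Pi.single_apply, if_neg]
          intro h
          have := congrArg Fin.val h
          rw [Fin.val_rev, hval, hval] at this
          omega
      rw [hτ, Fin.rev_rev] at h
      simp only [h0, mul_zero, zero_mul, sub_zero, add_zero, zero_add] at h
      have hn' := hne (ix hn k).rev
      rw [Fin.rev_rev] at hn'
      exact (mul_eq_zero.1 h).resolve_left hn'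
    ext m
    have h := hv (Pi.single m.rev 1)
    rw [hτ, Fin.rev_rev] at h
    simp only [hfirst, mul_zero, zero_mul, sub_zero, add_zero, zero_add] at h
    have hn' := hne m.rev
    rw [Fin.rev_rev] at hn'
    exact (mul_eq_zero.1 h).resolve_left hn'

/-- A 2-form on `ℝ⁴` whose restriction to the span of the first three basis vectors vanishes is
degenerate. -/
theorem not_nondeg_of_apply_ex_eq_zero (hn : 2 ≤ 2)
    {η : (Fin (2 * 2) → ℝ) [⋀^Fin 2]→L[ℝ] ℝ} (h : ∀ k l, η ![ex hn k, ex hn l] = 0) :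
    ¬ Nondeg η := by
  intro hη
  have hex : ∀ u, (∀ l, η ![u, ex hn l] = 0) → η ![u, Pi.single 3 1] = 0 → u = 0 :=
    fun u hu hu3 => hη u fun w => by
      rw [apply_swap, apply_eq_sum η w, neg_eq_zero]
      refine Finset.sum_eq_zero fun j _ => ?_
      rw [apply_swap]
      by_cases hj : 3 ≤ (j : ℕ)
      · have : j = 3 := Fin.ext (by change (j : ℕ) = 3; omega)
        rw [this, hu3, neg_zero, mul_zero]
      · obtain ⟨k, rfl⟩ := exists_ix_eq hn hj
        have := hu k
        rw [ex] at this
        rw [this, neg_zero, mul_zero]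
  have hne : ∀ k, ex hn k ≠ 0 := fun k h0 => by
    have := congrFun h0 (ix hn k)
    rw [ex_apply_ix] at this
    simp at this
  set s := η ![ex hn 0, Pi.single 3 1] with hs
  set t := η ![ex hn 1, Pi.single 3 1] with ht
  -- a vector of the plane of the first two basis vectors that pairs to zero with the fourth
  have hu := hex (t • ex hn 0 + (-s) • ex hn 1) (fun l => by
    rw [apply_add_left, apply_smul_left, apply_smul_left, h, h, mul_zero, mul_zero, add_zero]) (by
    rw [apply_add_left, apply_smul_left, apply_smul_left, ← hs, ← ht]; ring)
  have hs0 : s = 0 := by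
    have := congrFun hu (ix hn 1)
    simpa [ex_apply_ix] using this
  exact hne 0 (hex _ (h 0) hs0)

theorem algRestr_sum_mem_sympRestr_iff (h2 : n = 2) (c : Fin 8 → ℝ) :
    algRestr (W8 hn) (∑ i, c i • thetaGerm hn i) ∈ sympRestr (W8 hn) ↔
      (c 0, c 1, c 2) ≠ (0, 0, 0) := by
  subst h2
  constructor
  · rintro ⟨g, ⟨-, hg⟩, hgc⟩ hc
    simp only [Prod.mk.injEq] at hc
    obtain ⟨σ, hσ, rfl⟩ := exists_eq_ofSmooth g
    have hnd : Nondeg (σ 0) := Eventually.self_of_nhds (p := fun x => Nondeg (σ x)) hg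
    refine not_nondeg_of_apply_ex_eq_zero hn (fun k l => ?_) hnd
    rw [← sub_eq_zero, ← map_sub, algRestr_eq_zero_iff, sum_thetaGerm, sub_eq_add_neg,
      ← neg_one_smul ℝ, ofSmooth_smul, ofSmooth_add] at hgc
    obtain ⟨⟨h0, h1, h2⟩, -⟩ := jet_of_mem_zeroAlgRestr hn hgc
    have key : ∀ k l, σ 0 ![ex hn k, ex hn l] +
        (-1 : ℝ) * (∑ i, c i • theta hn i 0) ![ex hn k, ex hn l] = 0 →
          σ 0 ![ex hn k, ex hn l] = 0 := fun k l h => by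
      rw [sum_theta_zero_apply, hc.1, hc.2.1, hc.2.2] at h
      simpa using h
    have k0 := key 1 2 h0
    have k1 := key 0 2 h1
    have k2 := key 0 1 h2
    have hself : ∀ u, σ 0 ![u, u] = 0 := fun u => by
      have := apply_swap (σ 0) u u
      linarith
    fin_cases k <;> fin_cases l
    exacts [hself _, k2, k1, by rw [apply_swap]; exact neg_eq_zero.2 k2, hself _, k0,
      by rw [apply_swap]; exact neg_eq_zero.2 k1, by rw [apply_swap]; exact neg_eq_zero.2 k0,
      hself _]
  · intro hc
    have hpos : c 0 ^ 2 + c 1 ^ 2 + c 2 ^ 2 ≠ 0 := by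
      intro h
      apply hc
      have e0 : c 0 = 0 := by nlinarith [sq_nonneg (c 0), sq_nonneg (c 1), sq_nonneg (c 2)]
      have e1 : c 1 = 0 := by nlinarith [sq_nonneg (c 0), sq_nonneg (c 1), sq_nonneg (c 2)]
      have e2 : c 2 = 0 := by nlinarith [sq_nonneg (c 0), sq_nonneg (c 1), sq_nonneg (c 2)]
      rw [e0, e1, e2]
    let y : (Fin (2 * 2) → ℝ) →L[ℝ] ℝ := ContinuousLinearMap.proj 3
    -- the linear form for which the Pfaffian of the sum is `c_1² + c_2² + c_3²`
    let ξ : (Fin (2 * 2) → ℝ) →L[ℝ] ℝ := c 0 • dx hn 0 - c 1 • dx hn 1 + c 2 • dx hn 2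
    refine mem_sympRestr_of_nondeg hn (κ := wedge ξ y) ?_ fun v hv => ?_
    · rw [algRestr_const_wedge, wedgeRestr_swap, relation_coord hn (le_refl 3), neg_zero]
    · have hv' : ∀ w : Fin (2 * 2) → ℝ,
          c 0 * (v 1 * w 2 - w 1 * v 2) + c 1 * (v 0 * w 2 - w 0 * v 2) +
          c 2 * (v 0 * w 1 - w 0 * v 1) + ((c 0 * v 0 - c 1 * v 1 + c 2 * v 2) * w 3 -
            (c 0 * w 0 - c 1 * w 1 + c 2 * w 2) * v 3) = 0 := fun w => by
        have h := hv w
        rw [ContinuousAlternatingMap.add_apply, sum_theta_zero_apply, wedge_apply] at h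
        exact h
      have w0 := hv' ![1, 0, 0, 0]
      have w1 := hv' ![0, 1, 0, 0]
      have w2 := hv' ![0, 0, 1, 0]
      have w3 := hv' ![0, 0, 0, 1]
      simp at w0 w1 w2 w3
      have z : ∀ {r : ℝ}, (c 0 ^ 2 + c 1 ^ 2 + c 2 ^ 2) * r = 0 → r = 0 := fun h =>
        (mul_eq_zero.1 h).resolve_left hpos
      have e3 : v 3 = 0 := z (by linear_combination -c 0 * w0 + c 1 * w1 - c 2 * w2)
      have e0 : v 0 = 0 := z (by linear_combination c 0 * w3 + c 2 * w1 + c 1 * w2)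
      have e1 : v 1 = 0 := z (by linear_combination -c 1 * w3 + c 0 * w2 - c 2 * w0)
      have e2 : v 2 = 0 := z (by linear_combination c 2 * w3 - c 0 * w1 - c 1 * w0)
      ext j
      fin_cases j
      exacts [e0, e1, e2, e3]

end Symplectic

end SymplecticW8

end

theorem mainTheorem5 (n : ℕ) (hn : 2 ≤ n) :
    -- `[Z²(ℝ^{2n})]_{W_8}` is 8-dimensional, with basis `[θ_1], …, [θ_8]`
    (Module.finrank ℝ (SymplecticW8.closedRestr (SymplecticW8.W8 hn)) = 8 ∧
      LinearIndependent ℝ (fun i : Fin 8 =>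
        SymplecticW8.algRestr (SymplecticW8.W8 hn) (SymplecticW8.thetaGerm hn i)) ∧
      Submodule.span ℝ (Set.range fun i : Fin 8 =>
        SymplecticW8.algRestr (SymplecticW8.W8 hn) (SymplecticW8.thetaGerm hn i)) =
          SymplecticW8.closedRestr (SymplecticW8.W8 hn)) ∧
    -- `θ_i` is quasi-homogeneous of degree `δ_i` for the weights `6, 5, 4` of `x_1, x_2, x_3`
    (∀ w : Fin (2 * n) → ℝ, (∀ j, 0 < w j) → w (SymplecticW8.ix hn 0) = 6 →
      w (SymplecticW8.ix hn 1) = 5 → w (SymplecticW8.ix hn 2) = 4 →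
      ∀ i : Fin 8, SymplecticW8.IsQuasiHomogeneous w (SymplecticW8.degree i)
        (SymplecticW8.theta hn i)) ∧
    -- for `n ≥ 3` every algebraic restriction of a closed form is that of a symplectic form
    (3 ≤ n → SymplecticW8.sympRestr (SymplecticW8.W8 hn) =
      (SymplecticW8.closedRestr (SymplecticW8.W8 hn) : Set _)) ∧
    -- for `n = 2` these are the `[c_1 θ_1 + ⋯ + c_8 θ_8]` with `(c_1, c_2, c_3) ≠ (0, 0, 0)`,
    -- which form an open part of the 8-space
    (n = 2 →
      SymplecticW8.sympRestr (SymplecticW8.W8 hn) =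
        {a | ∃ c : Fin 8 → ℝ, (c 0, c 1, c 2) ≠ (0, 0, 0) ∧
          a = SymplecticW8.algRestr (SymplecticW8.W8 hn)
            (∑ i, c i • SymplecticW8.thetaGerm hn i)} ∧
      IsOpen {c : Fin 8 → ℝ | SymplecticW8.algRestr (SymplecticW8.W8 hn)
        (∑ i, c i • SymplecticW8.thetaGerm hn i) ∈
          SymplecticW8.sympRestr (SymplecticW8.W8 hn)}) := by
  have hli := SymplecticW8.linearIndependent_algRestr_theta hn
  have hspan := SymplecticW8.span_algRestr_theta hn
  refine ⟨⟨?_, hli, hspan⟩, fun w _ h0 h1 h2 => SymplecticW8.isQuasiHomogeneous_theta hn h0 h1 h2,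
    SymplecticW8.sympRestr_eq_closedRestr hn, fun h2 => ⟨?_, ?_⟩⟩
  · rw [← hspan, finrank_span_eq_card hli, Fintype.card_fin]
  · ext a
    constructor
    · intro ha
      obtain ⟨g, hg, rfl⟩ := SymplecticW8.sympRestr_subset hn ha
      obtain ⟨c, hc⟩ := SymplecticW8.exists_algRestr_eq_of_closed hn hg
      rw [hc] at ha
      exact ⟨c, (SymplecticW8.algRestr_sum_mem_sympRestr_iff hn h2 c).1 ha, hc⟩
    · rintro ⟨c, hc, rfl⟩
      exact (SymplecticW8.algRestr_sum_mem_sympRestr_iff hn h2 c).2 hc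
  · simp only [SymplecticW8.algRestr_sum_mem_sympRestr_iff hn h2]
    exact isOpen_ne_fun (by fun_prop) continuous_const
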